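/- Let $I=(-1,1)$ and let $b,f\in C^2(\overline I)$ be real-valued with $b(x)\ge\underline b>0$ for all $x\in\overline I$, for some constant $\underline b$. For $\varepsilon\in(0,1]$ let $u_\varepsilon\in H^1_0(I)$ be the (weak) solution of $$-\varepsilon^2u_\varepsilon''+b\,u_\varepsilon=f\ \text{ in } I,\qquad u_\varepsilon(\pm1)=0,$$ that is, $\int_I(\varepsilon^2u_\varepsilon'v'+b\,u_\varepsilon v)\,dx=\int_I fv\,dx$ for all $v\in H^1_0(I)$. For $w\in H^1(I)$ put $\|w\|_{1,\varepsilon,I}=\big(\int_I(\varepsilon^2(w')^2+b\,w^2)\,dx\big)^{1/2}$. For $N\ge2$ let $\mathcal{NN}^{\mathrm{ReLU}}_{2,N,1,1}$ be the set of feedforward ReLU neural networks $\Phi$ with one-dimensional input and output, depth $2$ (one hidden layer followed by an affine output layer) and width $N$ (that is, $N$ neurons in the hidden layer), and let $\mathrm R(\Phi):\mathbb R\to\mathbb R$ be the function realized by $\Phi$. Then there is a constant $C>0$, which may depend on $b$ and $f$ but not on $\varepsilon$ or $N$, such that for every integer $N\ge2$ and every $\varepsilon\in(0,1]$ there is a network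 $\Phi\in\mathcal{NN}^{\mathrm{ReLU}}_{2,N,1,1}$ with $$\|u_\varepsilon-\mathrm R(\Phi)\|_{1,\varepsilon,I}\le C\,N^{-1}\log N\quad\text{and}\quad \|u_\varepsilon-\mathrm R(\Phi)\|_{L^2(I)}\le C\,(N^{-1}\log N)^2 .$$ In particular, $$\inf_{\Phi\in\mathcal{NN}^{\mathrm{ReLU}}_{2,N,1,1}}\|u_\varepsilon-\mathrm R(\Phi)\|_{1,\varepsilon,I}\le C\,N^{-1}\log N,\qquad \inf_{\Phi\in\mathcal{NN}^{\mathrm{ReLU}}_{2,N,1,1}}\|u_\varepsilon-\mathrm R(\Phi)\|_{L^2(I)}\le C\,(N^{-1}\log N)^2 .$$ -/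

import Mathlib

open MeasureTheory Set

noncomputable section

namespace ReactDiff

/-! ### The interval `I = (-1,1)` and its Sobolev spaces -/

/-- The open interval `I = (-1, 1)`. -/
def I : Set ℝ := Ioo (-1) 1

/-- Lebesgue measure on `I`. -/
def volI : Measure ℝ := volume.restrict I

/-- `g` is a weak derivative of `u` on `I`: both are locally integrable on `I`, and
`∫_I u φ' = - ∫_I g φ` for every test function `φ ∈ C_c^∞(I)`. -/
def HasWeakDeriv (u g : ℝ → ℝ) : Prop :=
  LocallyIntegrableOn u I ∧ LocallyIntegrableOn g I ∧
    ∀ φ : ℝ → ℝ, ContDiff ℝ (⊤ : ℕ∞) φ → HasCompactSupport φ → tsupport φ ⊆ I →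
      ∫ x, u x * deriv φ x ∂volI = - ∫ x, g x * φ x ∂volI

open Classical in
/-- The weak derivative of `u` on `I` (unique up to null sets when it exists; the value `0` is
used if there is none, which never happens for the functions of `H¹(I)`). -/
def weakDeriv (u : ℝ → ℝ) : ℝ → ℝ :=
  if h : ∃ g, HasWeakDeriv u g then h.choose else 0

/-- `u ∈ H¹(I)`: `u ∈ L²(I)` has a weak derivative in `L²(I)`. -/
def MemH1 (u : ℝ → ℝ) : Prop :=
  MemLp u 2 volI ∧ ∃ g, HasWeakDeriv u g ∧ MemLp g 2 volI

/-- `u ∈ H¹₀(I)`: `u ∈ H¹(I)` has vanishing traces at `±1`, the traces being the endpoint values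
of the representative of `u` that is continuous on `[-1,1]`. -/
def MemH10 (u : ℝ → ℝ) : Prop :=
  MemH1 u ∧ ∃ v : ℝ → ℝ, ContinuousOn v (Icc (-1) 1) ∧ v =ᵐ[volI] u ∧ v (-1) = 0 ∧ v 1 = 0

/-! ### The singularly perturbed reaction-diffusion problem -/

/-- The bilinear form `B_ε(w, v) = ∫_I (ε² w' v' + b w v) dx`. -/
def bilin (ε : ℝ) (b w v : ℝ → ℝ) : ℝ :=
  ∫ x, (ε ^ 2 * (weakDeriv w x * weakDeriv v x) + b x * (w x * v x)) ∂volI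

/-- `u` is a (weak) solution of `-ε² u'' + b u = f` in `I`, `u(±1) = 0`: `u ∈ H¹₀(I)` and
`B_ε(u, v) = ∫_I f v dx` for every `v ∈ H¹₀(I)`. -/
def IsSolution (ε : ℝ) (b f u : ℝ → ℝ) : Prop :=
  MemH10 u ∧ ∀ v : ℝ → ℝ, MemH10 v → bilin ε b u v = ∫ x, f x * v x ∂volI

/-- The norm of `L²(I)`. -/
def l2Norm (w : ℝ → ℝ) : ℝ := Real.sqrt (∫ x, w x ^ 2 ∂volI)

/-- The energy norm `‖w‖_{1,ε,I} = (∫_I (ε² (w')² + b w²) dx)^{1/2}`, for `w ∈ H¹(I)`. -/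
def energyNorm (ε : ℝ) (b w : ℝ → ℝ) : ℝ :=
  Real.sqrt (∫ x, (ε ^ 2 * weakDeriv w x ^ 2 + b x * w x ^ 2) ∂volI)

/-! ### Feedforward neural networks -/

/-- Configurations `Φ = ((A₁,b₁), …, (A_L,b_L))` of feedforward neural networks with input
dimension `d` and output dimension `m`: either the output layer alone (`L = 1`), or a hidden layer
`(A₁, b₁)` with `n ≥ 1` neurons followed by a network with input dimension `n`. -/
inductive NN : ℕ → ℕ → Type
  | output {d m : ℕ} (A : Matrix (Fin m) (Fin d) ℝ) (c : Fin m → ℝ) : NN d m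
  | hidden {d n m : ℕ} (hn : 0 < n) (A : Matrix (Fin n) (Fin d) ℝ) (c : Fin n → ℝ)
      (Ψ : NN n m) : NN d m

/-- The depth (number of layers, including the output layer). -/
def NN.depth {d m : ℕ} : NN d m → ℕ
  | .output _ _ => 1
  | .hidden _ _ _ Ψ => Ψ.depth + 1

/-- The width `max (N₁, …, N_L)`, over the hidden layers and the output layer. -/
def NN.width : {d m : ℕ} → NN d m → ℕ
  | _, m, .output _ _ => m
  | _, _, .hidden (n := n) _ _ _ Ψ => max n Ψ.width

/-- The realization `R(Φ) : ℝ^d → ℝ^m` with activation `ρ`: every hidden layer maps `x` to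
`ρ (A x + c)` (`ρ` acting componentwise), the output layer maps `x` to `A x + c`. -/
def NN.realize (ρ : ℝ → ℝ) {d m : ℕ} : NN d m → (Fin d → ℝ) → (Fin m → ℝ)
  | .output A c, x => A.mulVec x + c
  | .hidden _ A c Ψ, x => Ψ.realize ρ (fun i => ρ ((A.mulVec x + c) i))

/-- The networks of depth `L` and width `W` with input dimension `d` and output dimension `m`. -/
def NNClass (L W d m : ℕ) : Set (NN d m) := {Φ | Φ.depth = L ∧ Φ.width = W}

/-- The activation function ReLU. -/
def relu (x : ℝ) : ℝ := max 0 x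

/-- The function `ℝ → ℝ` realized by a ReLU network with one-dimensional input and output. -/
def NN.reluFun (Φ : NN 1 1) (x : ℝ) : ℝ := Φ.realize relu (fun _ => x) 0

end ReactDiff

end

noncomputable section

namespace ReactDiff

open Filter Topology

/-! ### Weak derivatives on `I` -/

/-! The network realizes the piecewise linear interpolant of the solution on a Shishkin mesh, and
only a uniform error bound of order `(N⁻¹ log N)²` has to be proved.

Pointwise bounds. The weak solution has a classical representative `v`
(`IsSolution.exists_isClassical`). With `r = f / b`, the maximum principle gives `|v - r| ≤ A ε² +
R0 * layer` (`IsClassical.abs_sub_le`). Since `v'' = b (v - r) / ε²`, this also bounds `v''`, so no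
asymptotic expansion has to be differentiated.

Uniform error. In the fine parts `v'' = O(ε⁻²)` meets mesh widths of order `ε N⁻¹ log N`. In the
middle the layers are at most `2 N⁻²`: if `ε > N⁻¹` then `v''` is bounded there, and if `ε ≤ N⁻¹`
then `v` is `O(N⁻²)`-close to the smooth `r` (`abs_sub_linInterp_le_of_layer`).

Energy error. If `e = v - q` vanishes at the nodes of `q`, then `q'` is orthogonal to `e'`, and the
equation turns the squared energy norm into `∫ (f - b v + b e) e` (`IsSolution.energy_reluSum`). It
is thus bounded by a constant times `sup |e|`, and the square root gives the rate `N⁻¹ log N`. The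
L² rate is the uniform rate itself. -/

theorem integral_volI (F : ℝ → ℝ) : ∫ x, F x ∂volI = ∫ x in (-1)..1, F x := by
  rw [intervalIntegral.integral_of_le (by norm_num), integral_Ioc_eq_integral_Ioo]; rfl

theorem integrable_volI_iff {F : ℝ → ℝ} :
    Integrable F volI ↔ IntervalIntegrable F volume (-1) 1 := by
  rw [intervalIntegrable_iff_integrableOn_Ioo_of_le (by norm_num)]; rfl

theorem integrable_mul_test {u φ : ℝ → ℝ} (hu : LocallyIntegrableOn u I) (hφ : Continuous φ)
    (hc : HasCompactSupport φ) (hs : tsupport φ ⊆ I) :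
    Integrable (fun x => u x * φ x) volI := by
  have h1 : IntegrableOn u (tsupport φ) := hu.integrableOn_compact_subset hs hc
  have h2 : IntegrableOn (fun x => u x * φ x) (tsupport φ) :=
    h1.mul_continuousOn hφ.continuousOn hc
  have h3 : Integrable (fun x => u x * φ x) := by
    rwa [integrableOn_iff_integrable_of_support_subset] at h2
    intro x hx
    exact subset_tsupport φ (right_ne_zero_of_mul hx)
  exact h3.restrict

theorem ae_eq_zero_of_forall_test {u : ℝ → ℝ} (hu : LocallyIntegrableOn u I)
    (h : ∀ φ : ℝ → ℝ, ContDiff ℝ (⊤ : ℕ∞) φ → HasCompactSupport φ → tsupport φ ⊆ I →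
      ∫ x, u x * φ x ∂volI = 0) : u =ᵐ[volI] 0 := by
  have := isOpen_Ioo.ae_eq_zero_of_integral_contDiff_smul_eq_zero (μ := volume) hu
    (fun g hg hc hs => by
      rw [← h g hg hc hs, volI, setIntegral_eq_integral_of_forall_compl_eq_zero]
      · simp [mul_comm]
      · intro x hx
        rw [image_eq_zero_of_notMem_tsupport (fun h' => hx (hs h')), mul_zero])
  exact (ae_restrict_iff' measurableSet_Ioo).2 this

/-- The fundamental lemma of the calculus of variations applied to `g - k`. It allows the chosen
`weakDeriv` to be replaced by any explicit weak derivative. -/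
theorem HasWeakDeriv.unique {u g k : ℝ → ℝ} (hg : HasWeakDeriv u g) (hk : HasWeakDeriv u k) :
    g =ᵐ[volI] k := by
  have := ae_eq_zero_of_forall_test (u := g - k) (hg.2.1.sub hk.2.1) (fun φ h1 h2 h3 => by
    have e1 := hg.2.2 φ h1 h2 h3
    have e2 := hk.2.2 φ h1 h2 h3
    simp only [Pi.sub_apply, sub_mul]
    rw [integral_sub (integrable_mul_test hg.2.1 h1.continuous h2 h3)
      (integrable_mul_test hk.2.1 h1.continuous h2 h3)]
    linarith)
  filter_upwards [this] with x hx
  simpa [sub_eq_zero] using hx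

theorem HasWeakDeriv.weakDeriv {u g : ℝ → ℝ} (hg : HasWeakDeriv u g) :
    HasWeakDeriv u (weakDeriv u) := by
  have h : ∃ g, HasWeakDeriv u g := ⟨g, hg⟩
  rw [ReactDiff.weakDeriv, dif_pos h]
  exact h.choose_spec

theorem HasWeakDeriv.weakDeriv_ae_eq {u g : ℝ → ℝ} (hg : HasWeakDeriv u g) :
    ReactDiff.weakDeriv u =ᵐ[volI] g :=
  hg.weakDeriv.unique hg

theorem locallyIntegrableOn_congr {u v : ℝ → ℝ} (h : u =ᵐ[volI] v)
    (hu : LocallyIntegrableOn u I) : LocallyIntegrableOn v I := by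
  intro x hx
  obtain ⟨s, hs, hi⟩ := hu x hx
  refine ⟨s ∩ I, inter_mem hs self_mem_nhdsWithin, ?_⟩
  exact (hi.mono_set inter_subset_left).congr_fun_ae
    (ae_mono (Measure.restrict_mono inter_subset_right le_rfl) h)

theorem HasWeakDeriv.congr {u v g k : ℝ → ℝ} (h : HasWeakDeriv u g) (huv : u =ᵐ[volI] v)
    (hgk : g =ᵐ[volI] k) : HasWeakDeriv v k := by
  refine ⟨locallyIntegrableOn_congr huv h.1, locallyIntegrableOn_congr hgk h.2.1,
    fun φ h1 h2 h3 => ?_⟩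
  have e := h.2.2 φ h1 h2 h3
  have e1 := integral_congr_ae (huv.mul (EventuallyEq.refl _ (deriv φ)))
  have e2 := integral_congr_ae (hgk.mul (EventuallyEq.refl _ φ))
  simp only [Pi.mul_apply] at e1 e2
  rw [← e1, ← e2, e]

theorem locallyIntegrableOn_of_integrable {u : ℝ → ℝ} (h : Integrable u volI) :
    LocallyIntegrableOn u I :=
  IntegrableOn.locallyIntegrableOn h

/-- Subtracting weak derivatives. -/
theorem HasWeakDeriv.sub {u v g k : ℝ → ℝ} (hu : HasWeakDeriv u g) (hv : HasWeakDeriv v k) :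
    HasWeakDeriv (u - v) (g - k) := by
  refine ⟨hu.1.sub hv.1, hu.2.1.sub hv.2.1, fun φ h1 h2 h3 => ?_⟩
  have e1 := hu.2.2 φ h1 h2 h3
  have e2 := hv.2.2 φ h1 h2 h3
  have hd : Continuous (deriv φ) := h1.continuous_deriv (by simp)
  have hdc : HasCompactSupport (deriv φ) := h2.deriv
  have hds : tsupport (deriv φ) ⊆ I := (tsupport_deriv_subset (𝕜 := ℝ)).trans h3
  simp only [Pi.sub_apply, sub_mul]
  rw [integral_sub (integrable_mul_test hu.1 hd hdc hds) (integrable_mul_test hv.1 hd hdc hds),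
    integral_sub (integrable_mul_test hu.2.1 h1.continuous h2 h3)
      (integrable_mul_test hv.2.1 h1.continuous h2 h3)]
  linarith

/-- Integration by parts needs only right derivatives, which ReLU sums possess even at their kinks.
-/
theorem hasWeakDeriv_of_hasDerivWithinAt_Ioi {w g : ℝ → ℝ} (hw : ContinuousOn w (Icc (-1) 1))
    (hd : ∀ x ∈ Ioo (-1 : ℝ) 1, HasDerivWithinAt w (g x) (Ioi x) x)
    (hg : IntervalIntegrable g volume (-1) 1) : HasWeakDeriv w g := by
  refine ⟨hw.locallyIntegrableOn measurableSet_Icc |>.mono_set Ioo_subset_Icc_self,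
    locallyIntegrableOn_of_integrable (integrable_volI_iff.2 hg), fun φ h1 h2 h3 => ?_⟩
  have z1 : φ 1 = 0 := image_eq_zero_of_notMem_tsupport (fun h => by simpa [I] using h3 h)
  have z2 : φ (-1) = 0 := image_eq_zero_of_notMem_tsupport (fun h => by simpa [I] using h3 h)
  have := intervalIntegral.integral_mul_deriv_eq_deriv_mul_of_hasDeriv_right
    (u := w) (v := φ) (u' := g) (v' := deriv φ) (a := -1) (b := 1)
    (by rwa [uIcc_of_le (by norm_num)]) h1.continuous.continuousOn
    (by simpa using hd)
    (fun x _ => ((h1.differentiable (by simp)) x).hasDerivAt.hasDerivWithinAt) hg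
    ((h1.continuous_deriv (by simp)).intervalIntegrable _ _)
  rw [integral_volI, integral_volI, this, z1, z2]
  ring

theorem exists_radius_of_isCompact {K : Set ℝ} (hK : IsCompact K) (hs : K ⊆ I) :
    ∃ r : ℝ, 0 < r ∧ r < 1 ∧ K ⊆ Icc (-r) r := by
  -- Adjoining `1 / 2` makes the set nonempty and the radius positive, even if `K` is empty or
  -- `{0}`.
  have hK' : IsCompact (K ∪ {1 / 2}) := hK.union isCompact_singleton
  obtain ⟨y, hy, hm⟩ := hK'.exists_isMaxOn ⟨1 / 2, by simp⟩ continuous_abs.continuousOn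
  refine ⟨|y|, ?_, ?_, ?_⟩
  · have : |(1 / 2 : ℝ)| ≤ |y| := hm (show (1 / 2 : ℝ) ∈ K ∪ {1 / 2} by simp)
    exact lt_of_lt_of_le (by norm_num) this
  · rcases hy with h | h
    · exact abs_lt.2 (hs h)
    · rw [h]; norm_num [abs_of_pos]
  · intro x hx
    exact abs_le.1 (hm (Or.inl hx))

/-- A test function of integral zero is the derivative of a test function. -/
theorem exists_test_primitive {ζ : ℝ → ℝ} (h1 : ContDiff ℝ (⊤ : ℕ∞) ζ)
    (h2 : HasCompactSupport ζ) (h3 : tsupport ζ ⊆ I) (h0 : ∫ x in (-1)..1, ζ x = 0) :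
    ∃ ψ : ℝ → ℝ, ContDiff ℝ (⊤ : ℕ∞) ψ ∧ HasCompactSupport ψ ∧ tsupport ψ ⊆ I ∧
      deriv ψ = ζ := by
  obtain ⟨r, hr0, hr1, hr⟩ := exists_radius_of_isCompact h2 h3
  have hz : ∀ x, x ∉ Icc (-r) r → ζ x = 0 := fun x hx =>
    image_eq_zero_of_notMem_tsupport (fun h => hx (hr h))
  have hd : ∀ x, HasDerivAt (fun x => ∫ y in (-1)..x, ζ y) (ζ x) x := fun x =>
    intervalIntegral.integral_hasDerivAt_right (h1.continuous.intervalIntegrable _ _)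
      (h1.continuous.stronglyMeasurableAtFilter _ _) h1.continuous.continuousAt
  have hde : deriv (fun x => ∫ y in (-1)..x, ζ y) = ζ := funext fun x => (hd x).deriv
  have hsub : tsupport (fun x => ∫ y in (-1)..x, ζ y) ⊆ Icc (-r) r := by
    refine closure_minimal (fun x hx => ?_) isClosed_Icc
    by_contra hxn
    apply hx
    rw [mem_Icc, not_and_or, not_le, not_le] at hxn
    rcases hxn with h | h
    · refine intervalIntegral.integral_zero_ae (Eventually.of_forall fun y hy => hz y fun hy' => ?_)
      have : y ≤ max (-1) x := hy.2
      have h4 : max (-1) x < -r := max_lt (by linarith) h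
      linarith [hy'.1]
    -- To the right of the support the primitive equals the full integral; here the mean-zero
    -- hypothesis enters.
    · change ∫ y in (-1)..x, ζ y = 0
      rw [← intervalIntegral.integral_add_adjacent_intervals
        (h1.continuous.intervalIntegrable (-1) 1) (h1.continuous.intervalIntegrable 1 x), h0,
        zero_add]
      refine intervalIntegral.integral_zero_ae (Eventually.of_forall fun y hy => hz y fun hy' => ?_)
      have : min 1 x < y := hy.1
      have h4 : r < min 1 x := lt_min hr1 h
      linarith [hy'.2]
  refine ⟨fun x => ∫ y in (-1)..x, ζ y, ?_, ?_, ?_, hde⟩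
  · rw [contDiff_infty_iff_deriv, hde]
    exact ⟨fun x => (hd x).differentiableAt, h1⟩
  · exact isCompact_Icc.of_isClosed_subset (isClosed_tsupport _) hsub
  · exact hsub.trans (fun x hx => ⟨by linarith [hx.1], by linarith [hx.2]⟩)

theorem exists_test_integral_one :
    ∃ θ : ℝ → ℝ, ContDiff ℝ (⊤ : ℕ∞) θ ∧ HasCompactSupport θ ∧ tsupport θ ⊆ I ∧
      ∫ x in (-1)..1, θ x = 1 := by
  let B : ContDiffBump (0 : ℝ) := ⟨1 / 4, 1 / 2, by norm_num, by norm_num⟩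
  have hs : tsupport (B.normed volume) ⊆ I := by
    rw [B.tsupport_normed_eq, Real.closedBall_eq_Icc]
    intro x hx
    have h1 : (0 : ℝ) - 1 / 2 ≤ x := hx.1
    have h2 : x ≤ (0 : ℝ) + 1 / 2 := hx.2
    exact ⟨by linarith, by linarith⟩
  refine ⟨B.normed volume, B.contDiff_normed, B.hasCompactSupport_normed, hs, ?_⟩
  rw [← integral_volI, volI, setIntegral_eq_integral_of_forall_compl_eq_zero, B.integral_normed]
  exact fun x hx => image_eq_zero_of_notMem_tsupport (fun h' => hx (hs h'))

/-- A function with vanishing weak derivative is constant. -/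
theorem HasWeakDeriv.ae_eq_const {u : ℝ → ℝ} (hu : HasWeakDeriv u 0) :
    ∃ c : ℝ, u =ᵐ[volI] fun _ => c := by
  obtain ⟨θ, t1, t2, t3, t4⟩ := exists_test_integral_one
  refine ⟨∫ x, u x * θ x ∂volI, ?_⟩
  set c := ∫ x, u x * θ x ∂volI with hc
  have hconst : LocallyIntegrableOn (fun _ : ℝ => c) I :=
    (continuous_const.locallyIntegrable).locallyIntegrableOn _
  have := ae_eq_zero_of_forall_test (u := u - fun _ => c) (hu.1.sub hconst) fun φ h1 h2 h3 => by
    set m := ∫ x in (-1)..1, φ x with hm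
    have s0 : ContDiff ℝ (⊤ : ℕ∞) (fun x => m * θ x) := contDiff_const.mul t1
    have s2 : HasCompactSupport (fun x => m * θ x) := t2.mul_left
    have s3 : tsupport (fun x => m * θ x) ⊆ I := tsupport_mul_subset_right.trans t3
    -- Du Bois-Reymond: subtracting `m * θ` makes the integral zero, so the difference is the
    -- derivative of an admissible test function.
    obtain ⟨ψ, p1, p2, p3, p4⟩ := exists_test_primitive (ζ := φ - fun x => m * θ x)
      (h1.sub s0) (h2.sub s2)
      ((tsupport_sub φ _).trans (union_subset h3 s3))
      (by
        simp only [Pi.sub_apply]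
        rw [intervalIntegral.integral_sub (h1.continuous.intervalIntegrable _ _)
          (s0.continuous.intervalIntegrable _ _), intervalIntegral.integral_const_mul, t4]
        simp [hm])
    have e := hu.2.2 ψ p1 p2 p3
    rw [p4] at e
    simp only [Pi.sub_apply, Pi.zero_apply, zero_mul, integral_zero, neg_zero, mul_sub] at e
    rw [integral_sub (integrable_mul_test hu.1 h1.continuous h2 h3)
      (integrable_mul_test hu.1 s0.continuous s2 s3)] at e
    have e2 : ∫ x, u x * (m * θ x) ∂volI = m * c := by
      rw [hc, ← integral_const_mul]; congr 1; ext x; ring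
    simp only [Pi.sub_apply, sub_mul]
    rw [integral_sub (integrable_mul_test hu.1 h1.continuous h2 h3)
      (integrable_mul_test hconst h1.continuous h2 h3), integral_const_mul, integral_volI φ, ← hm]
    linarith
  filter_upwards [this] with x hx
  simpa [sub_eq_zero] using hx

/-! ### Regularity of weak solutions -/

/-- `v` is a classical solution with derivative `G`. -/
structure IsClassical (ε : ℝ) (b f v G : ℝ → ℝ) : Prop where
  continuousOn : ContinuousOn v (Icc (-1) 1)
  continuousOn_deriv : ContinuousOn G (Icc (-1) 1)
  left_eq_zero : v (-1) = 0
  right_eq_zero : v 1 = 0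
  hasDerivAt : ∀ x ∈ Ioo (-1 : ℝ) 1, HasDerivAt v (G x) x
  hasDerivAt_deriv : ∀ x ∈ Ioo (-1 : ℝ) 1, HasDerivAt G ((b x * v x - f x) / ε ^ 2) x

instance : IsFiniteMeasure volI := by
  unfold volI I; infer_instance

theorem aestronglyMeasurable_of_continuousOn {w : ℝ → ℝ} (hw : ContinuousOn w (Icc (-1) 1)) :
    AEStronglyMeasurable w volI :=
  (hw.mono Ioo_subset_Icc_self).aestronglyMeasurable measurableSet_Ioo

theorem memLp_of_continuousOn {w : ℝ → ℝ} (hw : ContinuousOn w (Icc (-1) 1)) :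
    MemLp w 2 volI := by
  obtain ⟨C, hC⟩ := isCompact_Icc.exists_bound_of_continuousOn hw
  refine MemLp.of_bound (aestronglyMeasurable_of_continuousOn hw) C ?_
  exact (ae_restrict_iff' measurableSet_Ioo).2
    (Eventually.of_forall fun x hx => hC x (Ioo_subset_Icc_self hx))

theorem integrable_of_continuousOn {w : ℝ → ℝ} (hw : ContinuousOn w (Icc (-1) 1)) :
    Integrable w volI :=
  (memLp_of_continuousOn hw).integrable (by norm_num)

theorem exists_primitive {k : ℝ → ℝ} (hk : ContinuousOn k (Icc (-1) 1)) :
    ∃ K : ℝ → ℝ, Continuous K ∧ ∀ x ∈ Ioo (-1 : ℝ) 1, HasDerivAt K (k x) x := by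
  -- Constant extension beyond the end points gives a function continuous on all of `ℝ` with the
  -- same values on the interval.
  set kk : ℝ → ℝ := IccExtend (by norm_num : (-1 : ℝ) ≤ 1) ((Icc (-1) 1).domRestrict k) with hkk
  have hc : Continuous kk := hk.domRestrict.Icc_extend'
  have hd : ∀ x, HasDerivAt (fun x => ∫ y in (-1)..x, kk y) (kk x) x := fun x =>
    intervalIntegral.integral_hasDerivAt_right (hc.intervalIntegrable _ _)
      (hc.stronglyMeasurableAtFilter _ _) hc.continuousAt
  refine ⟨fun x => ∫ y in (-1)..x, kk y,
    continuous_iff_continuousAt.2 fun x => (hd x).continuousAt, fun x hx => ?_⟩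
  have : kk x = k x := by
    rw [hkk, IccExtend_of_mem _ _ (Ioo_subset_Icc_self hx)]; rfl
  rw [← this]; exact hd x

theorem hasWeakDeriv_of_hasDerivAt {w g : ℝ → ℝ} (hw : ContinuousOn w (Icc (-1) 1))
    (hg : ContinuousOn g (Icc (-1) 1)) (hd : ∀ x ∈ Ioo (-1 : ℝ) 1, HasDerivAt w (g x) x) :
    HasWeakDeriv w g :=
  hasWeakDeriv_of_hasDerivWithinAt_Ioi hw (fun x hx => (hd x hx).hasDerivWithinAt)
    (integrable_volI_iff.1 (integrable_of_continuousOn hg))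

/-- A weak derivative that is continuous differs from any primitive by a constant. -/
theorem HasWeakDeriv.exists_ae_eq_add_const {w g K : ℝ → ℝ} (h : HasWeakDeriv w g)
    (hg : ContinuousOn g (Icc (-1) 1)) (hK : Continuous K)
    (hd : ∀ x ∈ Ioo (-1 : ℝ) 1, HasDerivAt K (g x) x) :
    ∃ c : ℝ, w =ᵐ[volI] fun x => K x + c := by
  have h2 := h.sub (hasWeakDeriv_of_hasDerivAt hK.continuousOn hg hd)
  rw [sub_self] at h2
  obtain ⟨c, hc⟩ := h2.ae_eq_const
  refine ⟨c, ?_⟩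
  filter_upwards [hc] with x hx
  simp only [Pi.sub_apply] at hx
  linarith

theorem memH10_of_test {φ : ℝ → ℝ} (h1 : ContDiff ℝ (⊤ : ℕ∞) φ) (h3 : tsupport φ ⊆ I) :
    MemH10 φ ∧ HasWeakDeriv φ (deriv φ) := by
  have hd : Continuous (deriv φ) := h1.continuous_deriv (by simp)
  have hw : HasWeakDeriv φ (deriv φ) := hasWeakDeriv_of_hasDerivAt h1.continuous.continuousOn
    hd.continuousOn fun x _ => ((h1.differentiable (by simp)) x).hasDerivAt
  refine ⟨⟨⟨memLp_of_continuousOn h1.continuous.continuousOn, _, hw,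
    memLp_of_continuousOn hd.continuousOn⟩, φ, h1.continuous.continuousOn, ae_eq_refl _, ?_, ?_⟩, hw⟩
  · exact image_eq_zero_of_notMem_tsupport (fun h => by simpa [I] using h3 h)
  · exact image_eq_zero_of_notMem_tsupport (fun h => by simpa [I] using h3 h)

theorem eqOn_Icc_of_ae_eq {v w : ℝ → ℝ} (h : v =ᵐ[volI] w) (hv : ContinuousOn v (Icc (-1) 1))
    (hw : ContinuousOn w (Icc (-1) 1)) : EqOn v w (Icc (-1) 1) := by
  refine Measure.eqOn_Icc_of_ae_eq volume (by norm_num) ?_ hv hw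
  rw [← restrict_Ioo_eq_restrict_Icc]
  exact h

/-- Testing with smooth functions shows that `u'` has the continuous weak derivative `(b v - f) /
ε²`. A function with a continuous weak derivative is a primitive of it up to a constant; this is
applied to `u'` and then to `v`. -/
theorem IsSolution.exists_isClassical {ε : ℝ} {b f u : ℝ → ℝ} (hε : 0 < ε)
    (hb : ContinuousOn b (Icc (-1) 1)) (hf : ContinuousOn f (Icc (-1) 1))
    (hu : IsSolution ε b f u) : ∃ v G, IsClassical ε b f v G ∧ v =ᵐ[volI] u := by
  obtain ⟨⟨⟨hL, g0, hg0, -⟩, v, hv, hvu, hl, hr⟩, hsol⟩ := hu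
  have hg := hg0.weakDeriv
  set g := weakDeriv u with hgdef
  set k : ℝ → ℝ := fun x => (b x * v x - f x) / ε ^ 2 with hk
  have hkc : ContinuousOn k (Icc (-1) 1) := ((hb.mul hv).sub hf).div_const _
  have hgk : HasWeakDeriv g k := by
    refine ⟨hg.2.1, locallyIntegrableOn_of_integrable (integrable_of_continuousOn hkc),
      fun φ h1 h2 h3 => ?_⟩
    obtain ⟨hφ, hφd⟩ := memH10_of_test h1 h3
    have hd : Continuous (deriv φ) := h1.continuous_deriv (by simp)
    have e := hsol φ hφ
    have e1 : bilin ε b u φ = ∫ x, (ε ^ 2 * (g x * deriv φ x) + b x * v x * φ x) ∂volI := by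
      refine integral_congr_ae ?_
      filter_upwards [hφd.weakDeriv_ae_eq, hvu] with x hx hx2
      rw [hx, hx2]; ring
    have i1 : Integrable (fun x => g x * deriv φ x) volI :=
      integrable_mul_test hg.2.1 hd h2.deriv ((tsupport_deriv_subset (𝕜 := ℝ)).trans h3)
    have i2 : Integrable (fun x => b x * v x * φ x) volI :=
      integrable_of_continuousOn ((hb.mul hv).mul h1.continuous.continuousOn)
    have i3 : Integrable (fun x => f x * φ x) volI :=
      integrable_of_continuousOn (hf.mul h1.continuous.continuousOn)
    rw [e1, integral_add (i1.const_mul _) i2, integral_const_mul] at e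
    have e2 : ∫ x, k x * φ x ∂volI =
        (∫ x, b x * v x * φ x ∂volI - ∫ x, f x * φ x ∂volI) / ε ^ 2 := by
      rw [← integral_sub i2 i3, ← integral_div]
      congr 1; ext x; simp only [hk]; ring
    rw [e2]
    field_simp
    linarith
  obtain ⟨K, hKc, hKd⟩ := exists_primitive hkc
  obtain ⟨c, hc⟩ := hgk.exists_ae_eq_add_const hkc hKc hKd
  have hGc : Continuous fun x => K x + c := hKc.add continuous_const
  have hvG : HasWeakDeriv v fun x => K x + c := hg.congr hvu.symm hc
  obtain ⟨V, hVc, hVd⟩ := exists_primitive hGc.continuousOn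
  obtain ⟨d, hd⟩ := hvG.exists_ae_eq_add_const hGc.continuousOn hVc hVd
  have heq := eqOn_Icc_of_ae_eq hd hv (hVc.add continuous_const).continuousOn
  refine ⟨v, fun x => K x + c, ⟨hv, hGc.continuousOn, hl, hr, fun x hx => ?_, fun x hx => ?_⟩, hvu⟩
  · refine ((hVd x hx).add_const d).congr_of_eventuallyEq ?_
    filter_upwards [isOpen_Ioo.mem_nhds hx] with y hy
    exact heq (Ioo_subset_Icc_self hy)
  · exact (hKd x hx).add_const c

/-! ### Linear combinations of shifted ReLU functions -/

theorem continuous_relu : Continuous relu := continuous_const.max continuous_id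

theorem relu_of_nonneg {x : ℝ} (h : 0 ≤ x) : relu x = x := max_eq_right h

theorem relu_of_nonpos {x : ℝ} (h : x ≤ 0) : relu x = 0 := max_eq_left h

/-- The Heaviside function, with value `1` at `0`. -/
def heaviside (x : ℝ) : ℝ := if 0 ≤ x then 1 else 0

theorem hasDerivWithinAt_relu (t x : ℝ) :
    HasDerivWithinAt (fun y => relu (y - t)) (heaviside (x - t)) (Ioi x) x := by
  unfold heaviside
  split_ifs with h
  · refine ((hasDerivAt_id x).sub_const t).hasDerivWithinAt.congr (fun y hy => ?_) ?_
    · exact relu_of_nonneg (by have : x < y := hy; linarith)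
    · exact relu_of_nonneg h
  · refine HasDerivAt.hasDerivWithinAt ((hasDerivAt_const x (0 : ℝ)).congr_of_eventuallyEq ?_)
    filter_upwards [Iio_mem_nhds (show x < t by linarith)] with y hy
    exact relu_of_nonpos (by have : y < t := hy; linarith)

theorem measurable_heaviside : Measurable heaviside :=
  Measurable.ite measurableSet_Ici measurable_const measurable_const

/-- The function `x ↦ ∑_{i < N} c_i ReLU(x - t_i)`. -/
def reluSum (N : ℕ) (c t : ℕ → ℝ) (x : ℝ) : ℝ := ∑ i ∈ Finset.range N, c i * relu (x - t i)

/-- The right derivative of `reluSum`. -/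
def reluSumDeriv (N : ℕ) (c t : ℕ → ℝ) (x : ℝ) : ℝ :=
  ∑ i ∈ Finset.range N, c i * heaviside (x - t i)

theorem continuous_reluSum (N : ℕ) (c t : ℕ → ℝ) : Continuous (reluSum N c t) :=
  continuous_finsetSum _ fun _ _ =>
    continuous_const.mul (continuous_relu.comp (continuous_id.sub continuous_const))

theorem hasDerivWithinAt_reluSum (N : ℕ) (c t : ℕ → ℝ) (x : ℝ) :
    HasDerivWithinAt (reluSum N c t) (reluSumDeriv N c t x) (Ioi x) x :=
  HasDerivWithinAt.fun_sum fun i _ => (hasDerivWithinAt_relu (t i) x).const_mul (c i)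

theorem memLp_heaviside (t : ℝ) : MemLp (fun x => heaviside (x - t)) 2 volI := by
  refine MemLp.of_bound
    (measurable_heaviside.comp (measurable_id.sub_const t)).aestronglyMeasurable 1
    (Eventually.of_forall fun x => ?_)
  unfold heaviside
  split_ifs <;> simp

theorem memLp_reluSumDeriv (N : ℕ) (c t : ℕ → ℝ) : MemLp (reluSumDeriv N c t) 2 volI :=
  memLp_finsetSum _ fun i _ => (memLp_heaviside (t i)).const_mul (c i)

/-- A ReLU network of depth `2` and width `N` realizing `reluSum N c t`. -/
theorem exists_nn_reluFun_eq {N : ℕ} (hN : 0 < N) (c t : ℕ → ℝ) :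
    ∃ Φ ∈ NNClass 2 N 1 1, ∀ x, Φ.reluFun x = reluSum N c t x := by
  refine ⟨.hidden hN (fun _ _ => 1) (fun i => -t i) (.output (fun _ i => c i) 0), ⟨rfl, ?_⟩,
    fun x => ?_⟩
  · simp [NN.width]; omega
  · simp [NN.reluFun, NN.realize, Matrix.mulVec, dotProduct, reluSum, Finset.sum_range,
      ← sub_eq_add_neg]

/-! ### The energy error of interpolants -/

/-- A step integrated against `e'` sees only the values of `e` at the jump and at `1`, whence the
orthogonality for interpolants. -/
theorem integral_heaviside_mul {e D : ℝ → ℝ} {t : ℝ} (ht : t ∈ Icc (-1 : ℝ) 1)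
    (he : ContinuousOn e (Icc (-1) 1))
    (hd : ∀ x ∈ Ioo (-1 : ℝ) 1, HasDerivWithinAt e (D x) (Ioi x) x)
    (hD : IntervalIntegrable D volume (-1) 1) :
    ∫ x, heaviside (x - t) * D x ∂volI = e 1 - e t := by
  have hm : t ∈ uIcc (-1 : ℝ) 1 := by rwa [uIcc_of_le (by norm_num)]
  have h1 : ∫ x in t..1, D x = e 1 - e t := by
    refine intervalIntegral.integral_eq_sub_of_hasDeriv_right_of_le ht.2
      (he.mono (Icc_subset_Icc_left ht.1)) (fun x hx => hd x ⟨lt_of_le_of_lt ht.1 hx.1, hx.2⟩) ?_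
    exact hD.mono_set (uIcc_subset_uIcc hm right_mem_uIcc)
  have hi : IntervalIntegrable (fun x => heaviside (x - t) * D x) volume (-1) 1 := by
    rw [← integrable_volI_iff] at hD ⊢
    refine hD.bdd_mul (c := 1)
      (measurable_heaviside.comp (measurable_id.sub_const t)).aestronglyMeasurable
      (Eventually.of_forall fun x => ?_)
    unfold heaviside
    split_ifs <;> simp
  rw [integral_volI, ← h1, ← intervalIntegral.integral_add_adjacent_intervals
    (hi.mono_set (uIcc_subset_uIcc left_mem_uIcc hm))
    (hi.mono_set (uIcc_subset_uIcc hm right_mem_uIcc)),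
    intervalIntegral.integral_zero_ae, zero_add]
  · refine intervalIntegral.integral_congr fun x hx => ?_
    rw [uIcc_of_le ht.2] at hx
    simp [heaviside, hx.1]
  · filter_upwards [Measure.ae_ne volume t] with x hx hx2
    rw [uIoc_of_le ht.1] at hx2
    have : x < t := lt_of_le_of_ne hx2.2 hx
    simp [heaviside, this]

/-- Expanding `(e')² = v' e' - q' e'`, the second term integrates to zero because `e` vanishes at
every active node and at `1`; the first is evaluated by the weak equation with test function `e`. No
derivative of the error remains. -/
theorem IsSolution.energy_reluSum {ε : ℝ} {b f u v G : ℝ → ℝ}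
    (hb : ContinuousOn b (Icc (-1) 1)) (hf : ContinuousOn f (Icc (-1) 1))
    (hu : IsSolution ε b f u) (hv : IsClassical ε b f v G) (hvu : v =ᵐ[volI] u)
    {N : ℕ} {c t : ℕ → ℝ} (hl : reluSum N c t (-1) = 0) (hr : reluSum N c t 1 = 0)
    (ht : ∀ i < N, c i = 0 ∨ t i ∈ Icc (-1 : ℝ) 1 ∧ reluSum N c t (t i) = v (t i)) :
    ∫ x, (ε ^ 2 * weakDeriv (fun x => u x - reluSum N c t x) x ^ 2
        + b x * (u x - reluSum N c t x) ^ 2) ∂volI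
      = ∫ x, (f x - b x * v x + b x * (v x - reluSum N c t x)) * (v x - reluSum N c t x) ∂volI := by
  set q := reluSum N c t with hq
  set q' := reluSumDeriv N c t with hq'
  set e : ℝ → ℝ := fun x => v x - q x with he
  set D : ℝ → ℝ := fun x => G x - q' x with hD
  have qc : Continuous q := continuous_reluSum N c t
  have ec : ContinuousOn e (Icc (-1) 1) := hv.continuousOn.sub qc.continuousOn
  have Gm : MemLp G 2 volI := memLp_of_continuousOn hv.continuousOn_deriv
  have Dm : MemLp D 2 volI := Gm.sub (memLp_reluSumDeriv N c t)
  have Di : IntervalIntegrable D volume (-1) 1 :=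
    integrable_volI_iff.1 (Dm.integrable (by norm_num))
  have ed : ∀ x ∈ Ioo (-1 : ℝ) 1, HasDerivWithinAt e (D x) (Ioi x) x := fun x hx =>
    (hv.hasDerivAt x hx).hasDerivWithinAt.sub (hasDerivWithinAt_reluSum N c t x)
  have eW : HasWeakDeriv e D := hasWeakDeriv_of_hasDerivWithinAt_Ioi ec ed Di
  have eu : e =ᵐ[volI] fun x => u x - q x := by
    filter_upwards [hvu] with x hx
    simp only [he, hx]
  have EW : HasWeakDeriv (fun x => u x - q x) D := eW.congr eu (ae_eq_refl _)
  have e1 : e 1 = 0 := by simp [he, hv.right_eq_zero, hr]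
  have e0 : e (-1) = 0 := by simp [he, hv.left_eq_zero, hl]
  have hE : MemH10 fun x => u x - q x :=
    ⟨⟨(memLp_of_continuousOn ec).ae_eq eu, D, EW, Dm⟩, e, ec, eu, e0, e1⟩
  have uW : HasWeakDeriv u G :=
    (hasWeakDeriv_of_hasDerivAt hv.continuousOn hv.continuousOn_deriv hv.hasDerivAt).congr hvu
      (ae_eq_refl _)
  have sol : ∫ x, (ε ^ 2 * (G x * D x) + b x * (v x * e x)) ∂volI = ∫ x, f x * e x ∂volI := by
    have := hu.2 _ hE
    have r1 : ∫ x, f x * (u x - q x) ∂volI = ∫ x, f x * e x ∂volI := by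
      refine integral_congr_ae ?_
      filter_upwards [eu] with x hx
      rw [hx]
    rw [r1] at this
    rw [← this]
    refine integral_congr_ae ?_
    filter_upwards [eu, hvu, EW.weakDeriv_ae_eq, uW.weakDeriv_ae_eq] with x h1 h2 h3 h4
    rw [h1, h2, h3, h4]
  have orth : ∫ x, q' x * D x ∂volI = 0 := by
    have hs : ∀ x, q' x * D x = ∑ i ∈ Finset.range N, c i * (heaviside (x - t i) * D x) := by
      intro x
      rw [hq', reluSumDeriv, Finset.sum_mul]
      exact Finset.sum_congr rfl fun i _ => by ring
    simp_rw [hs]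
    have hi : ∀ i ∈ Finset.range N,
        Integrable (fun x => c i * (heaviside (x - t i) * D x)) volI := fun i _ =>
      ((memLp_heaviside (t i)).integrable_mul Dm).const_mul (c i)
    rw [integral_finsetSum _ hi]
    refine Finset.sum_eq_zero fun i hi => ?_
    rw [integral_const_mul]
    rcases ht i (Finset.mem_range.1 hi) with h | ⟨h, h'⟩
    · rw [h, zero_mul]
    · rw [integral_heaviside_mul h ec ed Di, e1]
      simp [he, h']
  have i1 : Integrable (fun x => ε ^ 2 * (G x * D x) + b x * (v x * e x)) volI :=
    ((Gm.integrable_mul Dm).const_mul _).add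
      (integrable_of_continuousOn (hb.mul (hv.continuousOn.mul ec)))
  have i2 : Integrable (fun x => ε ^ 2 * (q' x * D x)) volI :=
    ((memLp_reluSumDeriv N c t).integrable_mul Dm).const_mul _
  have i3 : Integrable (fun x => (b x * e x - b x * v x) * e x) volI :=
    integrable_of_continuousOn (((hb.mul ec).sub (hb.mul hv.continuousOn)).mul ec)
  have i4 : Integrable (fun x => f x * e x) volI := integrable_of_continuousOn (hf.mul ec)
  calc ∫ x, (ε ^ 2 * weakDeriv (fun x => u x - q x) x ^ 2 + b x * (u x - q x) ^ 2) ∂volI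
      = ∫ x, (ε ^ 2 * (G x * D x) + b x * (v x * e x) - ε ^ 2 * (q' x * D x)
          + (b x * e x - b x * v x) * e x) ∂volI := by
        refine integral_congr_ae ?_
        filter_upwards [eu, EW.weakDeriv_ae_eq] with x h1 h2
        rw [← h1, h2]
        simp only [hD]
        ring
    _ = ∫ x, f x * e x ∂volI + ∫ x, (b x * e x - b x * v x) * e x ∂volI := by
        have i5 : Integrable (fun x => ε ^ 2 * (G x * D x) + b x * (v x * e x)
          - ε ^ 2 * (q' x * D x)) volI := i1.sub i2
        rw [integral_add i5 i3, integral_sub i1 i2, sol, integral_const_mul, orth]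
        ring
    _ = _ := by
        rw [← integral_add i4 i3]
        congr 1; ext x; ring

theorem integral_volI_le {F : ℝ → ℝ} {C : ℝ} (h : ∀ x ∈ Icc (-1 : ℝ) 1, |F x| ≤ C) :
    ∫ x, F x ∂volI ≤ 2 * C := by
  rw [integral_volI]
  have := intervalIntegral.norm_integral_le_of_norm_le_const (a := -1) (b := 1) (C := C) (f := F)
    (fun x hx => by
      rw [uIoc_of_le (by norm_num)] at hx
      exact h x (Ioc_subset_Icc_self hx))
  rw [Real.norm_eq_abs] at this
  have h2 : |(1 : ℝ) - -1| = 2 := by norm_num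
  rw [h2] at this
  linarith [le_abs_self (∫ x in (-1)..1, F x)]

theorem IsSolution.error_reluSum_le {ε : ℝ} {b f u v G : ℝ → ℝ}
    (hb : ContinuousOn b (Icc (-1) 1)) (hf : ContinuousOn f (Icc (-1) 1))
    (hu : IsSolution ε b f u) (hv : IsClassical ε b f v G) (hvu : v =ᵐ[volI] u)
    {N : ℕ} {c t : ℕ → ℝ} (hl : reluSum N c t (-1) = 0) (hr : reluSum N c t 1 = 0)
    (ht : ∀ i < N, c i = 0 ∨ t i ∈ Icc (-1 : ℝ) 1 ∧ reluSum N c t (t i) = v (t i))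
    {F B V δ : ℝ} (hF : ∀ x ∈ Icc (-1 : ℝ) 1, |f x| ≤ F) (hB : ∀ x ∈ Icc (-1 : ℝ) 1, |b x| ≤ B)
    (hV : ∀ x ∈ Icc (-1 : ℝ) 1, |v x| ≤ V)
    (hδ : ∀ x ∈ Icc (-1 : ℝ) 1, |v x - reluSum N c t x| ≤ δ) :
    energyNorm ε b (fun x => u x - reluSum N c t x) ≤ Real.sqrt (2 * ((F + B * V + B * δ) * δ)) ∧
      l2Norm (fun x => u x - reluSum N c t x) ≤ 2 * δ := by
  have h1 : (-1 : ℝ) ∈ Icc (-1 : ℝ) 1 := by norm_num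
  have B0 : 0 ≤ B := (abs_nonneg _).trans (hB _ h1)
  have V0 : 0 ≤ V := (abs_nonneg _).trans (hV _ h1)
  have δ0 : 0 ≤ δ := (abs_nonneg _).trans (hδ _ h1)
  have F0 : 0 ≤ F := (abs_nonneg _).trans (hF _ h1)
  constructor
  · refine Real.sqrt_le_sqrt ?_
    rw [hu.energy_reluSum hb hf hv hvu hl hr ht]
    refine integral_volI_le fun x hx => ?_
    rw [abs_mul]
    refine mul_le_mul ?_ (hδ x hx) (abs_nonneg _) (by positivity)
    calc |f x - b x * v x + b x * (v x - reluSum N c t x)|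
        ≤ |f x| + |b x| * |v x| + |b x| * |v x - reluSum N c t x| := by
          refine (abs_add_le _ _).trans ?_
          rw [abs_mul (b x) (v x - _)]
          gcongr
          refine (abs_sub _ _).trans ?_
          rw [abs_mul]
      _ ≤ _ := by
          gcongr
          exacts [hF x hx, hB x hx, hV x hx, hB x hx, hδ x hx]
  · refine Real.sqrt_le_iff.2 ⟨by positivity, ?_⟩
    have : ∫ x, (u x - reluSum N c t x) ^ 2 ∂volI = ∫ x, (v x - reluSum N c t x) ^ 2 ∂volI := by
      refine integral_congr_ae ?_
      filter_upwards [hvu] with x hx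
      rw [hx]
    rw [this]
    have h2 := integral_volI_le (F := fun x => (v x - reluSum N c t x) ^ 2) (C := δ ^ 2)
      (fun x hx => by
        rw [abs_pow]
        exact pow_le_pow_left₀ (abs_nonneg _) (hδ x hx) 2)
    nlinarith

/-! ### Maximum principle and pointwise bounds -/

/-- A minimum principle: `z` is nonnegative if it is so at the end points and `z'' < 0` wherever
`z < 0`. -/
theorem nonneg_of_deriv2_neg {z z1 z2 : ℝ → ℝ} (hz : ContinuousOn z (Icc (-1) 1))
    (hl : 0 ≤ z (-1)) (hr : 0 ≤ z 1) (h1 : ∀ x ∈ Ioo (-1 : ℝ) 1, HasDerivAt z (z1 x) x)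
    (h2 : ∀ x ∈ Ioo (-1 : ℝ) 1, HasDerivAt z1 (z2 x) x)
    (h : ∀ x ∈ Ioo (-1 : ℝ) 1, z x < 0 → z2 x < 0) : ∀ x ∈ Icc (-1 : ℝ) 1, 0 ≤ z x := by
  obtain ⟨y, hy, hm⟩ := isCompact_Icc.exists_isMinOn (nonempty_Icc.2 (by norm_num)) hz
  suffices h0 : 0 ≤ z y from fun x hx => h0.trans (hm hx)
  by_contra! hneg
  have hyI : y ∈ Ioo (-1 : ℝ) 1 := by
    refine ⟨lt_of_le_of_ne hy.1 ?_, lt_of_le_of_ne hy.2 ?_⟩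
    · rintro rfl; linarith
    · rintro rfl; linarith
  have hnb : Ioo (-1 : ℝ) 1 ∈ 𝓝 y := isOpen_Ioo.mem_nhds hyI
  have hmin : IsLocalMin z y := by
    filter_upwards [hnb] with x hx using hm (Ioo_subset_Icc_self hx)
  have hd : deriv z =ᶠ[𝓝 y] z1 := by
    filter_upwards [hnb] with x hx using (h1 x hx).deriv
  have hdd : deriv (deriv z) y = z2 y := by rw [hd.deriv_eq, (h2 y hyI).deriv]
  -- A negative interior minimum is also a local maximum by the second derivative test, so `z` is
  -- locally constant and `z'' = 0` there, a contradiction.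
  have hmax : IsLocalMax z y :=
    isLocalMax_of_deriv_deriv_neg (by rw [hdd]; exact h y hyI hneg) hmin.deriv_eq_zero
      (h1 y hyI).continuousAt
  have hc : z =ᶠ[𝓝 y] fun _ => z y := by
    filter_upwards [hmin, hmax] with x hx hx' using le_antisymm hx' hx
  have hc1 : deriv z =ᶠ[𝓝 y] fun _ => 0 := by
    have := hc.deriv
    simpa using this
  have : deriv (deriv z) y = 0 := by rw [hc1.deriv_eq]; simp
  linarith [h y hyI hneg]

/-- The sum of the two boundary layer functions. -/
def layer (β ε x : ℝ) : ℝ := Real.exp (-(β / ε) * (x + 1)) + Real.exp (-(β / ε) * (1 - x))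

theorem layer_nonneg (β ε x : ℝ) : 0 ≤ layer β ε x := by unfold layer; positivity

theorem hasDerivAt_exp_mul_add (k m x : ℝ) :
    HasDerivAt (fun x => Real.exp (k * x + m)) (k * Real.exp (k * x + m)) x := by
  have h : HasDerivAt (fun x : ℝ => k * x + m) k x := by
    simpa using ((hasDerivAt_id x).const_mul k).add_const m
  simpa [mul_comm] using h.exp

theorem exists_hasDerivAt_layer (β ε : ℝ) : ∃ l : ℝ → ℝ,
    (∀ x, HasDerivAt (layer β ε) (l x) x) ∧
      ∀ x, HasDerivAt l ((β / ε) ^ 2 * layer β ε x) x := by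
  set k := β / ε with hk
  have e : layer β ε = fun x => Real.exp (-k * x + -k) + Real.exp (k * x + -k) := by
    ext x; unfold layer; rw [← hk]; congr 2 <;> ring
  rw [e]
  refine ⟨fun x => -k * Real.exp (-k * x + -k) + k * Real.exp (k * x + -k), fun x =>
    (hasDerivAt_exp_mul_add _ _ _).add (hasDerivAt_exp_mul_add _ _ _), fun x => ?_⟩
  refine (((hasDerivAt_exp_mul_add (-k) (-k) x).const_mul (-k)).add
    ((hasDerivAt_exp_mul_add k (-k) x).const_mul k)).congr_deriv ?_
  ring

theorem layer_neg_one_ge (β ε : ℝ) : 1 ≤ layer β ε (-1) := by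
  unfold layer; simp; positivity

theorem layer_one_ge (β ε : ℝ) : 1 ≤ layer β ε 1 := by
  unfold layer; simp; positivity

theorem layer_le {k β ε x : ℝ} (h1 : k ≤ β / ε * (x + 1)) (h2 : k ≤ β / ε * (1 - x)) :
    layer β ε x ≤ 2 * Real.exp (-k) := by
  unfold layer
  have e1 : Real.exp (-(β / ε) * (x + 1)) ≤ Real.exp (-k) := Real.exp_le_exp.2 (by linarith)
  have e2 : Real.exp (-(β / ε) * (1 - x)) ≤ Real.exp (-k) := Real.exp_le_exp.2 (by linarith)
  linarith

/-- The distance of the solution to the solution `r = f / b` of the reduced problem. -/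
theorem IsClassical.abs_sub_le {ε : ℝ} {b f v G r r1 r2 : ℝ → ℝ} (hε : 0 < ε)
    (hv : IsClassical ε b f v G) {β R0 R2 : ℝ} (hβ : 0 < β)
    (hb : ∀ x ∈ Icc (-1 : ℝ) 1, β ^ 2 ≤ b x) (hbr : ∀ x ∈ Icc (-1 : ℝ) 1, b x * r x = f x)
    (hr : ContinuousOn r (Icc (-1) 1)) (h1 : ∀ x ∈ Ioo (-1 : ℝ) 1, HasDerivAt r (r1 x) x)
    (h2 : ∀ x ∈ Ioo (-1 : ℝ) 1, HasDerivAt r1 (r2 x) x)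
    (hR0 : ∀ x ∈ Icc (-1 : ℝ) 1, |r x| ≤ R0) (hR2 : ∀ x ∈ Ioo (-1 : ℝ) 1, |r2 x| ≤ R2) :
    ∀ x ∈ Icc (-1 : ℝ) 1, |v x - r x| ≤ R2 / β ^ 2 * ε ^ 2 + R0 * layer β ε x := by
  obtain ⟨l, hl1, hl2⟩ := exists_hasDerivAt_layer β ε
  have R0n : 0 ≤ R0 := (abs_nonneg _).trans (hR0 0 (by norm_num))
  have R2n : 0 ≤ R2 := (abs_nonneg _).trans (hR2 0 (by norm_num))
  -- Barrier argument for both signs. At the end points `R0 * layer ≥ R0` dominates `|r|`. Inside,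
  -- `ε² layer'' = β² layer` and `b ≥ β²` make the second derivative negative wherever the sum is
  -- negative.
  have key : ∀ s : ℝ, |s| = 1 → ∀ x ∈ Icc (-1 : ℝ) 1,
      0 ≤ (R2 / β ^ 2 * ε ^ 2 + R0 * layer β ε x) + s * (v x - r x) := by
    intro s hs
    have hbd : ∀ x ∈ Icc (-1 : ℝ) 1, v x = 0 → 1 ≤ layer β ε x →
        0 ≤ (R2 / β ^ 2 * ε ^ 2 + R0 * layer β ε x) + s * (v x - r x) := by
      intro x hx h0 hL
      have e1 : |s * (v x - r x)| ≤ R0 := by rw [abs_mul, hs, h0]; simpa using hR0 x hx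
      have e2 := (abs_le.1 e1).1
      have e3 : 0 ≤ R2 / β ^ 2 * ε ^ 2 := by positivity
      nlinarith
    have lc : Continuous (layer β ε) :=
      continuous_iff_continuousAt.2 fun x => (hl1 x).continuousAt
    refine nonneg_of_deriv2_neg
      (z1 := fun x => R0 * l x + s * (G x - r1 x))
      (z2 := fun x => R0 * ((β / ε) ^ 2 * layer β ε x) + s * ((b x * v x - f x) / ε ^ 2 - r2 x))
      ?_ (hbd _ (by norm_num) hv.left_eq_zero (layer_neg_one_ge β ε))
      (hbd _ (by norm_num) hv.right_eq_zero (layer_one_ge β ε)) ?_ ?_ ?_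
    · exact (continuousOn_const.add (continuousOn_const.mul lc.continuousOn)).add
        (continuousOn_const.mul (hv.continuousOn.sub hr))
    · intro x hx
      exact (((hl1 x).const_mul R0).const_add _).add
        (((hv.hasDerivAt x hx).sub (h1 x hx)).const_mul s)
    · intro x hx
      exact ((hl2 x).const_mul R0).add (((hv.hasDerivAt_deriv x hx).sub (h2 x hx)).const_mul s)
    · intro x hx hneg
      have hx' := Ioo_subset_Icc_self hx
      have hbx := hb x hx'
      have hβ2 : 0 < β ^ 2 := by positivity
      have hε2 : 0 < ε ^ 2 := by positivity
      have hL := layer_nonneg β ε x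
      have hsr : -(s * r2 x) ≤ R2 := by
        have : |s * r2 x| ≤ R2 := by rw [abs_mul, hs, one_mul]; exact hR2 x hx
        linarith [(abs_le.1 this).1]
      set w := s * (v x - r x) with hw
      have e1 : s * ((b x * v x - f x) / ε ^ 2 - r2 x) = b x * w / ε ^ 2 - s * r2 x := by
        rw [← hbr x hx', hw]; ring
      rw [e1]
      have e2 : R0 * ((β / ε) ^ 2 * layer β ε x) + (b x * w / ε ^ 2 - s * r2 x)
          = (β ^ 2 * (R0 * layer β ε x) + b x * w + ε ^ 2 * (-(s * r2 x))) / ε ^ 2 := by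
        field_simp
        ring
      rw [e2]
      refine div_neg_of_neg_of_pos ?_ hε2
      have e3 : ε ^ 2 * (-(s * r2 x)) ≤ ε ^ 2 * R2 := mul_le_mul_of_nonneg_left hsr hε2.le
      have e4 : R2 / β ^ 2 * ε ^ 2 * β ^ 2 = ε ^ 2 * R2 := by field_simp
      have e5 : 0 ≤ R2 / β ^ 2 * ε ^ 2 := by positivity
      have e6 : 0 ≤ R0 * layer β ε x := by positivity
      have e7 : b x * (R2 / β ^ 2 * ε ^ 2 + R0 * layer β ε x + w) < 0 :=
        mul_neg_of_pos_of_neg (by linarith) hneg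
      nlinarith
  intro x hx
  have k1 := key 1 (by simp) x hx
  have k2 := key (-1) (by simp) x hx
  exact abs_le.2 ⟨by linarith, by linarith⟩

theorem exists_deriv2_bound {r : ℝ → ℝ} (hr : ContDiffOn ℝ 2 r (Icc (-1) 1)) :
    ∃ (r1 r2 : ℝ → ℝ) (R : ℝ), (∀ x ∈ Ioo (-1 : ℝ) 1, HasDerivAt r (r1 x) x) ∧
      (∀ x ∈ Ioo (-1 : ℝ) 1, HasDerivAt r1 (r2 x) x) ∧ ∀ x ∈ Ioo (-1 : ℝ) 1, |r2 x| ≤ R := by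
  have hU : UniqueDiffOn ℝ (Icc (-1 : ℝ) 1) := uniqueDiffOn_Icc (by norm_num)
  have h1 : ContDiffOn ℝ 1 (derivWithin r (Icc (-1) 1)) (Icc (-1) 1) :=
    hr.derivWithin hU (by norm_num)
  have h2 : ContinuousOn (derivWithin (derivWithin r (Icc (-1) 1)) (Icc (-1) 1)) (Icc (-1) 1) :=
    h1.continuousOn_derivWithin hU le_rfl
  obtain ⟨R, hR⟩ := isCompact_Icc.exists_bound_of_continuousOn h2
  refine ⟨derivWithin r (Icc (-1) 1), _, R, fun x hx => ?_, fun x hx => ?_, fun x hx => hR x (Ioo_subset_Icc_self hx)⟩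
  · exact ((hr.differentiableOn (by norm_num)) x
      (Ioo_subset_Icc_self hx)).hasDerivWithinAt.hasDerivAt (Icc_mem_nhds hx.1 hx.2)
  · exact ((h1.differentiableOn (by norm_num)) x
      (Ioo_subset_Icc_self hx)).hasDerivWithinAt.hasDerivAt (Icc_mem_nhds hx.1 hx.2)

/-! ### Linear interpolation -/

/-- The affine function that interpolates `v` at `a` and `c`. -/
def linInterp (v : ℝ → ℝ) (a c x : ℝ) : ℝ := v a + (v c - v a) / (c - a) * (x - a)

theorem linInterp_left (v : ℝ → ℝ) (a c : ℝ) : linInterp v a c a = v a := by simp [linInterp]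

theorem linInterp_right (v : ℝ → ℝ) (a c : ℝ) : linInterp v a c c = v c := by
  unfold linInterp
  rcases eq_or_ne c a with rfl | h
  · simp
  · rw [div_mul_cancel₀ _ (sub_ne_zero.2 h)]; ring

/-- The chord slopes over `[a, c]` and `[a, x]` are values of `v'` by the mean value theorem, so
they differ by at most `M (c - a)`. -/
theorem abs_sub_linInterp_le {v v1 v2 : ℝ → ℝ} {a c M : ℝ} (hv : ContinuousOn v (Icc a c))
    (h1 : ∀ x ∈ Ioo a c, HasDerivAt v (v1 x) x) (h2 : ∀ x ∈ Ioo a c, HasDerivAt v1 (v2 x) x)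
    (hM : ∀ x ∈ Ioo a c, |v2 x| ≤ M) (hM0 : 0 ≤ M) {x : ℝ} (hx : x ∈ Icc a c) :
    |v x - linInterp v a c x| ≤ M * (c - a) ^ 2 := by
  rcases eq_or_lt_of_le hx.1 with rfl | hax
  · rw [linInterp_left, sub_self, abs_zero]; positivity
  have hac : a < c := hax.trans_le hx.2
  obtain ⟨ξ, hξ, eξ⟩ := exists_hasDerivAt_eq_slope v v1 hac hv h1
  obtain ⟨η, hη, eη⟩ := exists_hasDerivAt_eq_slope v v1 hax (hv.mono (Icc_subset_Icc_right hx.2))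
    fun y hy => h1 y ⟨hy.1, hy.2.trans_le hx.2⟩
  have hη' : η ∈ Ioo a c := ⟨hη.1, hη.2.trans_le hx.2⟩
  have hlip := (convex_Ioo a c).norm_image_sub_le_of_norm_hasDerivWithin_le (f := v1) (f' := v2)
    (fun y hy => (h2 y hy).hasDerivWithinAt) hM hξ hη'
  rw [Real.norm_eq_abs, Real.norm_eq_abs] at hlip
  have hd : |η - ξ| ≤ c - a := abs_le.2 ⟨by linarith [hξ.2, hη'.1], by linarith [hξ.1, hη'.2]⟩
  have e : v x - linInterp v a c x = (v1 η - v1 ξ) * (x - a) := by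
    unfold linInterp
    rw [← eξ, sub_mul, eη, div_mul_cancel₀ _ (sub_ne_zero.2 hax.ne')]
    ring
  rw [e, abs_mul, abs_of_pos (sub_pos.2 hax), sq, ← mul_assoc]
  refine mul_le_mul (hlip.trans (by gcongr)) (by linarith [hx.2]) (by linarith) ?_
  exact mul_nonneg hM0 (by linarith)

/-- The interpolation error of `v` is that of `r` plus that of `v - r`; the interpolant of `v - r`
is a convex combination of end point values. No regularity of `v` is used. -/
theorem abs_sub_linInterp_le_of_abs_sub_le {v r : ℝ → ℝ} {a c ω κ : ℝ}
    (hω : ∀ x ∈ Icc a c, |v x - r x| ≤ ω) {x : ℝ} (hx : x ∈ Icc a c)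
    (hr : |r x - linInterp r a c x| ≤ κ) : |v x - linInterp v a c x| ≤ κ + 2 * ω := by
  have hac : a ≤ c := hx.1.trans hx.2
  set θ := (x - a) / (c - a) with hθ
  have θ0 : 0 ≤ θ := div_nonneg (by linarith [hx.1]) (by linarith)
  have θ1 : θ ≤ 1 := div_le_one_of_le₀ (by linarith [hx.2]) (by linarith)
  have e : v x - linInterp v a c x = (r x - linInterp r a c x) + (v x - r x)
      - ((1 - θ) * (v a - r a) + θ * (v c - r c)) := by
    unfold linInterp; rw [hθ]; ring
  have b1 := abs_le.1 (hω x hx)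
  have b2 := abs_le.1 (hω a (left_mem_Icc.2 hac))
  have b3 := abs_le.1 (hω c (right_mem_Icc.2 hac))
  have b4 := abs_le.1 hr
  rw [e]
  refine abs_le.2 ⟨?_, ?_⟩ <;> nlinarith

/-- The slopes of the interpolant of `v` on the first `n` elements of the mesh `X`. -/
def slope (v : ℝ → ℝ) (X : ℕ → ℝ) (n i : ℕ) : ℝ :=
  if i < n then (v (X (i + 1)) - v (X i)) / (X (i + 1) - X i) else 0

/-- The jumps of the slopes. -/
def jump (v : ℝ → ℝ) (X : ℕ → ℝ) (n i : ℕ) : ℝ :=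
  slope v X n i - if i = 0 then 0 else slope v X n (i - 1)

/-- Summation by parts regroups the neurons into one ramp per element. -/
theorem reluSum_jump (v : ℝ → ℝ) (X : ℕ → ℝ) (n m : ℕ) (x : ℝ) :
    reluSum (m + 1) (jump v X n) X x =
      ∑ i ∈ Finset.range m, slope v X n i * (relu (x - X i) - relu (x - X (i + 1)))
        + slope v X n m * relu (x - X m) := by
  induction m with
  | zero => simp [reluSum, jump]
  | succ m ih =>
    unfold reluSum at ih ⊢
    rw [Finset.sum_range_succ, ih, Finset.sum_range_succ]
    simp only [jump, Nat.add_eq_zero_iff, one_ne_zero, and_false, if_false, Nat.add_sub_cancel]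
    ring

/-- Ramps left of `x` are saturated and telescope to `v (X k)`, as `v (X 0) = 0`; those to the right
vanish. -/
theorem reluSum_jump_eq_linInterp {v : ℝ → ℝ} {X : ℕ → ℝ} (hX : Monotone X) (h0 : v (X 0) = 0)
    {n N k : ℕ} (hN : n < N) (hk : k < n) {x : ℝ} (hx : x ∈ Icc (X k) (X (k + 1))) :
    reluSum N (jump v X n) X x = linInterp v (X k) (X (k + 1)) x := by
  obtain ⟨m, rfl⟩ : ∃ m, N = m + 1 := ⟨N - 1, by omega⟩
  have hm : slope v X n m = 0 := by simp [slope]; omega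
  rw [reluSum_jump, hm, zero_mul, add_zero]
  obtain ⟨j, rfl⟩ : ∃ j, m = k + 1 + j := ⟨m - (k + 1), by omega⟩
  rw [Finset.sum_range_add, Finset.sum_range_succ]
  have s1 : ∀ i ∈ Finset.range k,
      slope v X n i * (relu (x - X i) - relu (x - X (i + 1))) = v (X (i + 1)) - v (X i) := by
    intro i hi
    have hik : i < k := Finset.mem_range.1 hi
    have l1 : X (i + 1) ≤ x := (hX hik).trans hx.1
    have l2 : X i ≤ X (i + 1) := hX (Nat.le_succ i)
    rw [relu_of_nonneg (by linarith), relu_of_nonneg (by linarith), slope, if_pos (by omega)]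
    -- Elements of length zero are allowed: they occur in the middle part of the mesh when `τ = 1`.
    rcases eq_or_lt_of_le l2 with h | h
    · rw [h]; simp
    · have : X (i + 1) - X i ≠ 0 := by linarith
      field_simp
      ring
  have s2 : ∀ i ∈ Finset.range j, slope v X n (k + 1 + i) *
      (relu (x - X (k + 1 + i)) - relu (x - X (k + 1 + i + 1))) = 0 := by
    intro i _
    have l1 : x ≤ X (k + 1 + i) := hx.2.trans (hX (by omega))
    have l2 : x ≤ X (k + 1 + i + 1) := hx.2.trans (hX (by omega))
    rw [relu_of_nonpos (by linarith), relu_of_nonpos (by linarith), sub_zero, mul_zero]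
  rw [Finset.sum_congr rfl s1, Finset.sum_eq_zero s2, Finset.sum_range_sub (fun i => v (X i)), h0,
    relu_of_nonneg (by linarith [hx.1]), relu_of_nonpos (by linarith [hx.2]), slope, if_pos hk]
  unfold linInterp
  ring

theorem exists_mem_Icc_of_mem_Icc {X : ℕ → ℝ} {x : ℝ} (n : ℕ) (hn : 0 < n)
    (hx : x ∈ Icc (X 0) (X n)) : ∃ k < n, x ∈ Icc (X k) (X (k + 1)) := by
  induction n with
  | zero => omega
  | succ n ih =>
    rcases le_or_gt (X n) x with h | h
    · exact ⟨n, Nat.lt_succ_self n, h, hx.2⟩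
    · rcases Nat.eq_zero_or_pos n with rfl | hn'
      · exact absurd hx.1 (not_le.2 h)
      · obtain ⟨k, hk, hk'⟩ := ih hn' ⟨hx.1, h.le⟩
        exact ⟨k, by omega, hk'⟩

theorem jump_eq_zero_or_interpolates {v : ℝ → ℝ} {X : ℕ → ℝ} (hX : Monotone X) (h0 : v (X 0) = 0)
    {n N : ℕ} (hN : n < N) (hn : 0 < n) (i : ℕ) :
    jump v X n i = 0 ∨
      X i ∈ Icc (X 0) (X n) ∧ reluSum N (jump v X n) X (X i) = v (X i) := by
  rcases lt_or_ge n i with h | h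
  · left
    rw [jump, slope, slope, if_neg (by omega), if_neg (by omega), if_neg (by omega), sub_zero]
  · right
    refine ⟨⟨hX (Nat.zero_le i), hX h⟩, ?_⟩
    rcases lt_or_eq_of_le h with h | rfl
    · rw [reluSum_jump_eq_linInterp hX h0 hN h (left_mem_Icc.2 (hX (Nat.le_succ i))),
        linInterp_left]
    · obtain ⟨m, rfl⟩ : ∃ m, i = m + 1 := ⟨i - 1, by omega⟩
      rw [reluSum_jump_eq_linInterp hX h0 hN (Nat.lt_succ_self m)
        (right_mem_Icc.2 (hX (Nat.le_succ m))), linInterp_right]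

/-! ### Shishkin meshes -/

/-- The Shishkin mesh with transition parameter `τ` and `M` elements in each of its three parts. -/
theorem exists_shishkin_mesh {M : ℕ} (hM : 0 < M) {τ : ℝ} (hτ0 : 0 ≤ τ) (hτ1 : τ ≤ 1) :
    ∃ X : ℕ → ℝ, Monotone X ∧ X 0 = -1 ∧ X (3 * M) = 1 ∧ ∀ k < 3 * M,
      X (k + 1) - X k = τ / M ∨
        (-1 + τ ≤ X k ∧ X (k + 1) ≤ 1 - τ ∧ X (k + 1) - X k = (2 - 2 * τ) / M) := by
  have hM' : (0 : ℝ) < M := by exact_mod_cast hM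
  set h : ℕ → ℝ := fun j => if M ≤ j ∧ j < 2 * M then (2 - 2 * τ) / M else τ / M with hh
  set X : ℕ → ℝ := fun i => -1 + ∑ j ∈ Finset.range i, h j with hX
  have hstep : ∀ k, X (k + 1) - X k = h k := fun k => by
    simp only [hX, Finset.sum_range_succ]; ring
  have hpos : ∀ k, 0 ≤ h k := fun k => by
    simp only [hh]
    split_ifs
    · exact div_nonneg (by linarith) hM'.le
    · positivity
  have hmono : Monotone X := monotone_nat_of_le_succ fun k => by linarith [hstep k, hpos k]
  have s1 : ∑ j ∈ Finset.range M, h j = τ := by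
    rw [Finset.sum_congr rfl (g := fun _ => τ / M) fun j hj => if_neg (by
      have := Finset.mem_range.1 hj; omega)]
    simp; field_simp
  have s2 : ∑ j ∈ Finset.range M, h (M + j) = 2 - 2 * τ := by
    rw [Finset.sum_congr rfl (g := fun _ => (2 - 2 * τ) / M) fun j hj => if_pos (by
      have := Finset.mem_range.1 hj; omega)]
    simp; field_simp
  have s3 : ∑ j ∈ Finset.range M, h (M + M + j) = τ := by
    rw [Finset.sum_congr rfl (g := fun _ => τ / M) fun j hj => if_neg (by omega)]
    simp; field_simp
  have X1 : X M = -1 + τ := by simp only [hX, s1]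
  have X2 : X (M + M) = 1 - τ := by
    simp only [hX, Finset.sum_range_add, s1, s2]; ring
  have X3 : X (M + M + M) = 1 := by
    simp only [hX, Finset.sum_range_add, s1, s2, s3]; ring
  refine ⟨X, hmono, by simp [hX], ?_, fun k _ => ?_⟩
  · rw [← X3]; congr 1; ring
  · rw [hstep]
    by_cases hk : M ≤ k ∧ k < 2 * M
    · exact Or.inr ⟨X1 ▸ hmono hk.1, X2 ▸ hmono (by omega), if_pos hk⟩
    · exact Or.inl (if_neg hk)

/-! ### Approximation of functions with boundary layers -/

theorem layer_le_two {β ε x : ℝ} (hβ : 0 < β) (hε : 0 < ε) (hx : x ∈ Icc (-1 : ℝ) 1) :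
    layer β ε x ≤ 2 := by
  have h := layer_le (k := 0) (β := β) (ε := ε) (x := x)
    (mul_nonneg (by positivity) (by linarith [hx.1]))
    (mul_nonneg (by positivity) (by linarith [hx.2]))
  simpa using h

/-- Piecewise linear interpolation on a Shishkin mesh of a function `v` that is the sum of a smooth
part `r` and a boundary layer part. -/
theorem abs_sub_linInterp_le_of_layer {β ε A R0 R2 B τ L N a c : ℝ} {v v1 v2 r r1 r2 : ℝ → ℝ}
    (hβ : 0 < β) (hε : 0 < ε) (hε1 : ε ≤ 1) (hA : 0 ≤ A) (hR0 : 0 ≤ R0) (hR2 : 0 ≤ R2)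
    (hB : 0 ≤ B) (hN : 0 < N) (hL : L = Real.log N) (hL0 : 1 / 2 ≤ L)
    (hτ : τ = min 1 (2 / β * ε * L)) (hac : Icc a c ⊆ Icc (-1) 1)
    (hv : ContinuousOn v (Icc (-1) 1)) (hr : ContinuousOn r (Icc (-1) 1))
    (hv1 : ∀ x ∈ Ioo (-1 : ℝ) 1, HasDerivAt v (v1 x) x)
    (hv2 : ∀ x ∈ Ioo (-1 : ℝ) 1, HasDerivAt v1 (v2 x) x)
    (hr1 : ∀ x ∈ Ioo (-1 : ℝ) 1, HasDerivAt r (r1 x) x)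
    (hr2 : ∀ x ∈ Ioo (-1 : ℝ) 1, HasDerivAt r1 (r2 x) x)
    (hrb : ∀ x ∈ Ioo (-1 : ℝ) 1, |r2 x| ≤ R2)
    (hw : ∀ x ∈ Icc (-1 : ℝ) 1, |v x - r x| ≤ A * ε ^ 2 + R0 * layer β ε x)
    (hvb : ∀ x ∈ Ioo (-1 : ℝ) 1, |v2 x| ≤ B * (A * ε ^ 2 + R0 * layer β ε x) / ε ^ 2)
    (hmesh : c - a ≤ 6 * τ / N ∨ (-1 + τ ≤ a ∧ c ≤ 1 - τ ∧ c - a ≤ 12 / N)) {x : ℝ}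
    (hx : x ∈ Icc a c) :
    |v x - linInterp v a c x| ≤
      (144 / β ^ 2 * B * (A + 2 * R0) + 4 * (144 * R2 + 2 * (A + 2 * R0))
        + 576 * B * (A + 2 * R0)) * (N⁻¹ * L) ^ 2 := by
  have hac' : a ≤ c := hx.1.trans hx.2
  have hIoo : Ioo a c ⊆ Ioo (-1 : ℝ) 1 := by
    intro y hy
    have h1 := hac (left_mem_Icc.2 hac')
    have h2 := hac (right_mem_Icc.2 hac')
    exact ⟨h1.1.trans_lt hy.1, hy.2.trans_le h2.2⟩
  have hL0' : 0 < L := by linarith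
  set K := A + 2 * R0 with hK
  have K0 : 0 ≤ K := by positivity
  have t1 : 0 ≤ 144 / β ^ 2 * B * K * (N⁻¹ * L) ^ 2 := by positivity
  have t2 : 0 ≤ 4 * (144 * R2 + 2 * K) * (N⁻¹ * L) ^ 2 := by positivity
  have t3 : 0 ≤ 576 * B * K * (N⁻¹ * L) ^ 2 := by positivity
  have hε2 : 0 < ε ^ 2 := by positivity
  have hε21 : ε ^ 2 ≤ 1 := pow_le_one₀ hε.le hε1
  have hglob : ∀ y ∈ Ioo a c, |v2 y| ≤ B * K / ε ^ 2 := by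
    intro y hy
    refine (hvb y (hIoo hy)).trans ?_
    have := layer_le_two hβ hε (Ioo_subset_Icc_self (hIoo hy))
    have e1 : R0 * layer β ε y ≤ R0 * 2 := by gcongr
    have e2 : A * ε ^ 2 ≤ A * 1 := by gcongr
    gcongr
    linarith
  have err : ∀ {m d : ℝ}, (∀ y ∈ Ioo a c, |v2 y| ≤ m) → 0 ≤ m → c - a ≤ d →
      |v x - linInterp v a c x| ≤ m * d ^ 2 := fun {m d} hm hm0 hd =>
    (abs_sub_linInterp_le (hv.mono hac) (fun y hy => hv1 y (hIoo hy))
      (fun y hy => hv2 y (hIoo hy)) hm hm0 hx).trans (mul_le_mul_of_nonneg_left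
        (pow_le_pow_left₀ (by linarith) hd 2) hm0)
  have hτσ : τ ≤ 2 / β * ε * L := hτ ▸ min_le_right _ _
  rcases hmesh with h | ⟨h1, h2, h3⟩
  · have hd : c - a ≤ 6 * (2 / β * ε * L) / N := h.trans (by gcongr)
    have e := err hglob (by positivity) hd
    -- The powers of `ε` cancel: the fine width resolves the layer.
    have e2 : B * K / ε ^ 2 * (6 * (2 / β * ε * L) / N) ^ 2
        = 144 / β ^ 2 * B * K * (N⁻¹ * L) ^ 2 := by
      field_simp
      ring
    rw [e2] at e
    linarith
  -- If `τ = 1`, the middle elements have length zero.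
  rcases le_or_gt 1 (2 / β * ε * L) with hbig | hsmall
  · have hτ1 : τ = 1 := hτ.trans (min_eq_left hbig)
    have e := err hglob (by positivity) (d := 0) (by linarith)
    have : B * K / ε ^ 2 * (0 : ℝ) ^ 2 = 0 := by ring
    linarith
  · have hτe : τ = 2 / β * ε * L := hτ.trans (min_eq_right hsmall.le)
    -- The factor `2` in `τ` makes each exponential at most `exp (-2 log N) = N⁻²`.
    have hlay : ∀ y ∈ Icc a c, layer β ε y ≤ 2 * (N⁻¹) ^ 2 := by
      intro y hy
      have hk : 2 * L = β / ε * τ := by rw [hτe]; field_simp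
      have hb0 : 0 ≤ β / ε := by positivity
      have := layer_le (k := 2 * L) (β := β) (ε := ε) (x := y)
        (by rw [hk]; exact mul_le_mul_of_nonneg_left (by linarith [hy.1]) hb0)
        (by rw [hk]; exact mul_le_mul_of_nonneg_left (by linarith [hy.2]) hb0)
      refine this.trans_eq ?_
      rw [show -(2 * L) = -L + -L by ring, Real.exp_add, Real.exp_neg, hL, Real.exp_log hN]
      ring
    have hNL : (N⁻¹) ^ 2 ≤ 4 * (N⁻¹ * L) ^ 2 := by
      have : (1 / 2 : ℝ) ^ 2 ≤ L ^ 2 := pow_le_pow_left₀ (by norm_num) hL0 2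
      have h0 : 0 ≤ (N⁻¹) ^ 2 := by positivity
      rw [mul_pow]
      nlinarith
    -- For small `ε` compare with `r`; otherwise `N⁻² ≤ ε²` cancels the factor `ε⁻²` in the bound on
    -- `v''`.
    rcases le_or_gt ε N⁻¹ with hs | hl
    · have hω : ∀ y ∈ Icc a c, |v y - r y| ≤ K * (N⁻¹) ^ 2 := by
        intro y hy
        refine (hw y (hac hy)).trans ?_
        have e1 : A * ε ^ 2 ≤ A * (N⁻¹) ^ 2 := by gcongr
        have e2 : R0 * layer β ε y ≤ R0 * (2 * (N⁻¹) ^ 2) :=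
          mul_le_mul_of_nonneg_left (hlay y hy) hR0
        rw [hK]
        linarith
      have hκ : |r x - linInterp r a c x| ≤ R2 * (12 / N) ^ 2 :=
        (abs_sub_linInterp_le (hr.mono hac) (fun y hy => hr1 y (hIoo hy))
          (fun y hy => hr2 y (hIoo hy)) (fun y hy => hrb y (hIoo hy)) hR2 hx).trans
          (mul_le_mul_of_nonneg_left (pow_le_pow_left₀ (by linarith) h3 2) hR2)
      have e := abs_sub_linInterp_le_of_abs_sub_le hω hx hκ
      have e1 : R2 * (12 / N) ^ 2 + 2 * (K * (N⁻¹) ^ 2) = (144 * R2 + 2 * K) * (N⁻¹) ^ 2 := by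
        field_simp; ring
      have e2 : (144 * R2 + 2 * K) * (N⁻¹) ^ 2 ≤ (144 * R2 + 2 * K) * (4 * (N⁻¹ * L) ^ 2) := by
        gcongr
      rw [e1] at e
      linarith
    · have hm : ∀ y ∈ Ioo a c, |v2 y| ≤ B * K := by
        intro y hy
        refine (hvb y (hIoo hy)).trans ?_
        rw [div_le_iff₀ hε2, mul_assoc]
        refine mul_le_mul_of_nonneg_left ?_ hB
        have e2 : R0 * layer β ε y ≤ R0 * (2 * (N⁻¹) ^ 2) :=
          mul_le_mul_of_nonneg_left (hlay y (Ioo_subset_Icc_self hy)) hR0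
        have e3 : R0 * (2 * (N⁻¹) ^ 2) ≤ R0 * (2 * ε ^ 2) := by gcongr
        rw [hK]
        linarith
      have e := err hm (by positivity) h3
      have e1 : B * K * (12 / N) ^ 2 = 144 * B * K * (N⁻¹) ^ 2 := by
        field_simp; ring
      have e2 : 144 * B * K * (N⁻¹) ^ 2 ≤ 144 * B * K * (4 * (N⁻¹ * L) ^ 2) := by gcongr
      rw [e1] at e
      linarith

theorem half_le_log {N : ℕ} (hN : 2 ≤ N) : 1 / 2 ≤ Real.log N := by
  have h1 : Real.log 2 ≤ Real.log N := Real.log_le_log (by norm_num) (by exact_mod_cast hN)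
  linarith [Real.log_two_gt_d9]

/-- Approximation of a function with boundary layers by ReLU sums that interpolate it. -/
theorem exists_reluSum_approx {β ε A R0 R2 B V : ℝ} {v v1 v2 r r1 r2 : ℝ → ℝ} {N : ℕ}
    (hβ : 0 < β) (hε : 0 < ε) (hε1 : ε ≤ 1) (hA : 0 ≤ A) (hR0 : 0 ≤ R0) (hR2 : 0 ≤ R2)
    (hB : 0 ≤ B) (hN : 2 ≤ N)
    (hv : ContinuousOn v (Icc (-1) 1)) (hr : ContinuousOn r (Icc (-1) 1))
    (hvl : v (-1) = 0) (hvr : v 1 = 0)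
    (hv1 : ∀ x ∈ Ioo (-1 : ℝ) 1, HasDerivAt v (v1 x) x)
    (hv2 : ∀ x ∈ Ioo (-1 : ℝ) 1, HasDerivAt v1 (v2 x) x)
    (hr1 : ∀ x ∈ Ioo (-1 : ℝ) 1, HasDerivAt r (r1 x) x)
    (hr2 : ∀ x ∈ Ioo (-1 : ℝ) 1, HasDerivAt r1 (r2 x) x)
    (hrb : ∀ x ∈ Ioo (-1 : ℝ) 1, |r2 x| ≤ R2)
    (hw : ∀ x ∈ Icc (-1 : ℝ) 1, |v x - r x| ≤ A * ε ^ 2 + R0 * layer β ε x)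
    (hvb : ∀ x ∈ Ioo (-1 : ℝ) 1, |v2 x| ≤ B * (A * ε ^ 2 + R0 * layer β ε x) / ε ^ 2)
    (hV : ∀ x ∈ Icc (-1 : ℝ) 1, |v x| ≤ V) :
    ∃ c t : ℕ → ℝ, reluSum N c t (-1) = 0 ∧ reluSum N c t 1 = 0 ∧
      (∀ i < N, c i = 0 ∨ t i ∈ Icc (-1 : ℝ) 1 ∧ reluSum N c t (t i) = v (t i)) ∧
      ∀ x ∈ Icc (-1 : ℝ) 1, |v x - reluSum N c t x| ≤
        (64 * V + (144 / β ^ 2 * B * (A + 2 * R0) + 4 * (144 * R2 + 2 * (A + 2 * R0))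
          + 576 * B * (A + 2 * R0))) * ((N : ℝ)⁻¹ * Real.log N) ^ 2 := by
  have hL := half_le_log hN
  have hN0 : (0 : ℝ) < N := by exact_mod_cast (by omega : 0 < N)
  have V0 : 0 ≤ V := (abs_nonneg _).trans (hV 0 (by norm_num))
  set C := 144 / β ^ 2 * B * (A + 2 * R0) + 4 * (144 * R2 + 2 * (A + 2 * R0))
    + 576 * B * (A + 2 * R0) with hC
  have C0 : 0 ≤ C := by positivity
  -- A mesh with three parts needs at least four nodes. For `N < 4` the zero function suffices,
  -- since `N⁻¹ log N ≥ 1 / 8`; this produces the term `64 * V`.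
  rcases lt_or_ge N 4 with hlt | hge
  · have hz : ∀ x, reluSum N (fun _ => 0) (fun _ => 0) x = 0 := fun x => by simp [reluSum]
    refine ⟨fun _ => 0, fun _ => 0, hz _, hz _, fun i _ => Or.inl rfl, fun x hx => ?_⟩
    rw [hz, sub_zero]
    have h4 : (4 : ℝ)⁻¹ ≤ (N : ℝ)⁻¹ := inv_anti₀ hN0 (by exact_mod_cast hlt.le)
    have h8 : (1 / 8 : ℝ) ≤ (N : ℝ)⁻¹ * Real.log N := by nlinarith
    have h64 : (1 / 8 : ℝ) ^ 2 ≤ ((N : ℝ)⁻¹ * Real.log N) ^ 2 :=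
      pow_le_pow_left₀ (by norm_num) h8 2
    have := hV x hx
    nlinarith
  -- The `3 M + 1` nodes need at most `N` neurons, and `N ≤ 6 M` converts widths in `1 / M` to
  -- widths in `1 / N`.
  · obtain ⟨M, hM, hM1, hM2⟩ : ∃ M : ℕ, 0 < M ∧ 3 * M < N ∧ N ≤ 6 * M :=
      ⟨(N - 1) / 3, by omega, by omega, by omega⟩
    have hM' : (0 : ℝ) < M := by exact_mod_cast hM
    have hM2' : (N : ℝ) ≤ 6 * M := by exact_mod_cast hM2
    set τ := min 1 (2 / β * ε * Real.log N) with hτ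
    have hτ0 : 0 ≤ τ := le_min (by norm_num) (by positivity)
    obtain ⟨X, hX, X0, X1, hstep⟩ := exists_shishkin_mesh hM hτ0 (min_le_left _ _)
    have hv0 : v (X 0) = 0 := by rw [X0, hvl]
    have hnode := jump_eq_zero_or_interpolates hX hv0 hM1 (by omega)
    have hbound : ∀ x ∈ Icc (-1 : ℝ) 1, ∃ k < 3 * M, x ∈ Icc (X k) (X (k + 1)) := fun x hx =>
      exists_mem_Icc_of_mem_Icc (3 * M) (by omega) (by rwa [X0, X1])
    rw [X0, X1] at hnode
    have hMN : ∀ y : ℝ, 0 ≤ y → y / M ≤ 6 * y / N := fun y hy => by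
      rw [div_le_div_iff₀ hM' hN0]
      nlinarith
    refine ⟨jump v X (3 * M), X, ?_, ?_, fun i _ => hnode i, fun x hx => ?_⟩
    · have := reluSum_jump_eq_linInterp hX hv0 hM1 (by omega : 0 < 3 * M)
        (left_mem_Icc.2 (hX (Nat.le_succ 0)))
      rwa [linInterp_left, hv0, X0] at this
    · have h1 : 3 * M - 1 + 1 = 3 * M := by omega
      have := reluSum_jump_eq_linInterp hX hv0 hM1 (by omega : 3 * M - 1 < 3 * M)
        (right_mem_Icc.2 (hX (Nat.le_succ _)))
      rwa [linInterp_right, h1, X1, hvr] at this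
    · obtain ⟨k, hk, hxk⟩ := hbound x hx
      rw [reluSum_jump_eq_linInterp hX hv0 hM1 hk hxk]
      have hsub : Icc (X k) (X (k + 1)) ⊆ Icc (-1) 1 :=
        Icc_subset_Icc (X0 ▸ hX (Nat.zero_le k)) (X1 ▸ hX (by omega))
      refine (abs_sub_linInterp_le_of_layer hβ hε hε1 hA hR0 hR2 hB hN0 rfl hL hτ hsub hv hr hv1
        hv2 hr1 hr2 hrb hw hvb ?_ hxk).trans ?_
      · rcases hstep k hk with h | ⟨h1, h2, h3⟩
        · left
          rw [h]
          exact hMN τ hτ0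
        · refine Or.inr ⟨h1, h2, h3.le.trans ?_⟩
          have : (2 - 2 * τ) / M ≤ 2 / M := by gcongr; linarith
          have h12 := hMN 2 (by norm_num)
          linarith
      · exact mul_le_mul_of_nonneg_right (by linarith) (sq_nonneg _)

theorem IsClassical.exists_reluSum_approx {b f : ℝ → ℝ}
    (hb : ContDiffOn ℝ 2 b (Icc (-1) 1)) (hf : ContDiffOn ℝ 2 f (Icc (-1) 1))
    (hbpos : ∃ bmin : ℝ, 0 < bmin ∧ ∀ x ∈ Icc (-1 : ℝ) 1, bmin ≤ b x) :
    ∃ C V : ℝ, 0 ≤ C ∧ 0 ≤ V ∧ ∀ N : ℕ, 2 ≤ N → ∀ ε : ℝ, 0 < ε → ε ≤ 1 → ∀ v G : ℝ → ℝ,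
      IsClassical ε b f v G → (∀ x ∈ Icc (-1 : ℝ) 1, |v x| ≤ V) ∧
        ∃ c t : ℕ → ℝ, reluSum N c t (-1) = 0 ∧ reluSum N c t 1 = 0 ∧
          (∀ i < N, c i = 0 ∨ t i ∈ Icc (-1 : ℝ) 1 ∧ reluSum N c t (t i) = v (t i)) ∧
          ∀ x ∈ Icc (-1 : ℝ) 1, |v x - reluSum N c t x| ≤ C * ((N : ℝ)⁻¹ * Real.log N) ^ 2 := by
  obtain ⟨bmin, hb0, hbm⟩ := hbpos
  set β := Real.sqrt bmin with hβ
  have β0 : 0 < β := Real.sqrt_pos.2 hb0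
  have hβb : ∀ x ∈ Icc (-1 : ℝ) 1, β ^ 2 ≤ b x := fun x hx => by
    rw [hβ, Real.sq_sqrt hb0.le]; exact hbm x hx
  have hbne : ∀ x ∈ Icc (-1 : ℝ) 1, b x ≠ 0 := fun x hx => (hb0.trans_le (hbm x hx)).ne'
  set r : ℝ → ℝ := fun x => f x / b x with hr
  have hrC : ContDiffOn ℝ 2 r (Icc (-1) 1) := hf.div hb hbne
  have hbr : ∀ x ∈ Icc (-1 : ℝ) 1, b x * r x = f x := fun x hx => mul_div_cancel₀ _ (hbne x hx)
  obtain ⟨r1, r2, R2, hr1, hr2, hR2⟩ := exists_deriv2_bound hrC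
  obtain ⟨R0, hR0⟩ := isCompact_Icc.exists_bound_of_continuousOn hrC.continuousOn
  obtain ⟨B, hB⟩ := isCompact_Icc.exists_bound_of_continuousOn hb.continuousOn
  simp only [Real.norm_eq_abs] at hR0 hB
  have R0n : 0 ≤ R0 := (abs_nonneg _).trans (hR0 0 (by norm_num))
  have R2n : 0 ≤ R2 := (abs_nonneg _).trans (hR2 0 (by norm_num))
  have Bn : 0 ≤ B := (abs_nonneg _).trans (hB 0 (by norm_num))
  set A := R2 / β ^ 2 with hA
  have An : 0 ≤ A := by positivity
  refine ⟨64 * (A + 3 * R0) + (144 / β ^ 2 * B * (A + 2 * R0) + 4 * (144 * R2 + 2 * (A + 2 * R0))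
    + 576 * B * (A + 2 * R0)), A + 3 * R0, by positivity, by positivity,
    fun N hN ε hε hε1 v G hv => ?_⟩
  have hw := hv.abs_sub_le hε β0 hβb hbr hrC.continuousOn hr1 hr2 hR0 hR2
  have hV : ∀ x ∈ Icc (-1 : ℝ) 1, |v x| ≤ A + 3 * R0 := by
    intro x hx
    have e1 : A * ε ^ 2 ≤ A * 1 := by gcongr; exact pow_le_one₀ hε.le hε1
    have e2 : R0 * layer β ε x ≤ R0 * 2 := by gcongr; exact layer_le_two β0 hε hx
    have e3 : |v x| ≤ |v x - r x| + |r x| := by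
      simpa using abs_add_le (v x - r x) (r x)
    linarith [hw x hx, hR0 x hx]
  refine ⟨hV, ReactDiff.exists_reluSum_approx β0 hε hε1 An R0n R2n Bn hN hv.continuousOn
    hrC.continuousOn hv.left_eq_zero hv.right_eq_zero hv.hasDerivAt hv.hasDerivAt_deriv hr1 hr2
    hR2 hw (fun x hx => ?_) hV⟩
  have hx' := Ioo_subset_Icc_self hx
  -- Substituting `f = b r` gives `v'' = b (v - r) / ε²`.
  rw [abs_div, abs_of_pos (by positivity : (0 : ℝ) < ε ^ 2), ← hbr x hx', ← mul_sub, abs_mul]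
  gcongr
  exacts [hB x hx', hw x hx']

end ReactDiff

end

/-! ### Energy and L² rates from the uniform error -/

theorem proposition4p3 (b f : ℝ → ℝ)
    (hb : ContDiffOn ℝ 2 b (Set.Icc (-1) 1)) (hf : ContDiffOn ℝ 2 f (Set.Icc (-1) 1))
    (hbpos : ∃ bmin : ℝ, 0 < bmin ∧ ∀ x ∈ Set.Icc (-1 : ℝ) 1, bmin ≤ b x) :
    ∃ C : ℝ, 0 < C ∧ ∀ N : ℕ, 2 ≤ N → ∀ ε : ℝ, 0 < ε → ε ≤ 1 →
      ∀ u : ℝ → ℝ, ReactDiff.IsSolution ε b f u →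
        (∃ Φ ∈ ReactDiff.NNClass 2 N 1 1,
          ReactDiff.energyNorm ε b (fun x => u x - Φ.reluFun x)
            ≤ C * ((N : ℝ)⁻¹ * Real.log N) ∧
          ReactDiff.l2Norm (fun x => u x - Φ.reluFun x)
            ≤ C * ((N : ℝ)⁻¹ * Real.log N) ^ 2) ∧
        (⨅ Φ : ReactDiff.NNClass 2 N 1 1,
          ReactDiff.energyNorm ε b (fun x => u x - Φ.1.reluFun x))
            ≤ C * ((N : ℝ)⁻¹ * Real.log N) ∧
        (⨅ Φ : ReactDiff.NNClass 2 N 1 1,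
          ReactDiff.l2Norm (fun x => u x - Φ.1.reluFun x))
            ≤ C * ((N : ℝ)⁻¹ * Real.log N) ^ 2 := by
  obtain ⟨K, V, K0, V0, hK⟩ := ReactDiff.IsClassical.exists_reluSum_approx hb hf hbpos
  obtain ⟨F, hF⟩ := isCompact_Icc.exists_bound_of_continuousOn hf.continuousOn
  obtain ⟨B, hB⟩ := isCompact_Icc.exists_bound_of_continuousOn hb.continuousOn
  simp only [Real.norm_eq_abs] at hF hB
  have F0 : 0 ≤ F := (abs_nonneg _).trans (hF 0 (by norm_num))
  have B0 : 0 ≤ B := (abs_nonneg _).trans (hB 0 (by norm_num))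
  -- Since `ℓ ≤ 1`, the uniform error `δ = K ℓ²` is at most `K`, so the squared energy error is at
  -- most `S ℓ²`.
  set S := 2 * ((F + B * V + B * K) * K) with hS
  refine ⟨Real.sqrt S + 2 * K + 1, by positivity, fun N hN ε hε hε1 u hu => ?_⟩
  obtain ⟨v, G, hv, hvu⟩ := hu.exists_isClassical hε hb.continuousOn hf.continuousOn
  obtain ⟨hV, c, t, hl, hr, ht, hδ⟩ := hK N hN ε hε hε1 v G hv
  obtain ⟨hE, hL2⟩ := hu.error_reluSum_le hb.continuousOn hf.continuousOn hv hvu hl hr ht hF hB hV hδ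
  obtain ⟨Φ, hΦ, hΦx⟩ := ReactDiff.exists_nn_reluFun_eq (by omega : 0 < N) c t
  set ℓ := (N : ℝ)⁻¹ * Real.log N with hℓ
  have hN0 : (0 : ℝ) < N := by exact_mod_cast (by omega : 0 < N)
  have ℓ0 : 0 ≤ ℓ := by
    have := ReactDiff.half_le_log hN
    positivity
  have ℓ1 : ℓ ≤ 1 := by
    rw [hℓ, inv_mul_le_iff₀ hN0, mul_one]
    exact (Real.log_le_sub_one_of_pos hN0).trans (by linarith)
  have ℓ2 : ℓ ^ 2 ≤ 1 := pow_le_one₀ ℓ0 ℓ1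
  have hfun : (fun x => u x - Φ.reluFun x) = fun x => u x - ReactDiff.reluSum N c t x := by
    ext x; rw [hΦx]
  have h1 : ReactDiff.energyNorm ε b (fun x => u x - Φ.reluFun x)
      ≤ (Real.sqrt S + 2 * K + 1) * ℓ := by
    rw [hfun]
    refine hE.trans ?_
    have e : Real.sqrt (2 * ((F + B * V + B * (K * ℓ ^ 2)) * (K * ℓ ^ 2))) ≤ Real.sqrt S * ℓ := by
      rw [← Real.sqrt_sq ℓ0, ← Real.sqrt_mul (by positivity), Real.sqrt_sq ℓ0]
      refine Real.sqrt_le_sqrt ?_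
      have : K * ℓ ^ 2 ≤ K := mul_le_of_le_one_right K0 ℓ2
      calc 2 * ((F + B * V + B * (K * ℓ ^ 2)) * (K * ℓ ^ 2))
          ≤ 2 * ((F + B * V + B * K) * (K * ℓ ^ 2)) := by gcongr
        _ = S * ℓ ^ 2 := by rw [hS]; ring
    have : 0 ≤ (2 * K + 1) * ℓ := by positivity
    linarith
  have h2 : ReactDiff.l2Norm (fun x => u x - Φ.reluFun x)
      ≤ (Real.sqrt S + 2 * K + 1) * ℓ ^ 2 := by
    rw [hfun]
    refine hL2.trans ?_
    have : 0 ≤ (Real.sqrt S + 1) * ℓ ^ 2 := by positivity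
    linarith
  refine ⟨⟨Φ, hΦ, h1, h2⟩, ?_, ?_⟩
  · refine (ciInf_le ⟨0, ?_⟩ (⟨Φ, hΦ⟩ : ReactDiff.NNClass 2 N 1 1)).trans h1
    rintro _ ⟨Ψ, rfl⟩
    exact Real.sqrt_nonneg _
  · refine (ciInf_le ⟨0, ?_⟩ (⟨Φ, hΦ⟩ : ReactDiff.NNClass 2 N 1 1)).trans h2
    rintro _ ⟨Ψ, rfl⟩
    exact Real.sqrt_nonneg _
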